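/- **Setting.** All rectangles are axis-parallel, with positive width and height. For a rectangle $Q$ write $\operatorname{Perim}(Q)=\operatorname{width}(Q)+\operatorname{height}(Q)$ (half of the boundary length; this normalization does not affect ratios). Let $R$ be a rectangle and let $A_1,\dots,A_n>0$ satisfy $\sum_{i=1}^n A_i=\operatorname{Area}(R)$. A *partition of $R$ with areas $A_1,\dots,A_n$* is a family of rectangles $R_1,\dots,R_n$ with pairwise disjoint interiors, with $\bigcup_i R_i=R$ and with $\operatorname{Area}(R_i)=A_i$ for all $i$; its total perimeter is $\sum_i\operatorname{Perim}(R_i)$. **Algorithm ApproximationDC.** Input: a rectangle $Q$ and a list of positive areas with sum $\operatorname{Area}(Q)$. If the list consists of a single area, return $Q$. Otherwise sort the list in non-increasing order and regard each area as a block of its own. While there are more than two blocks, merge the last two blocks (the two smallest ones) into one block, whose area is the sum of theirs, and insert it into the list of blocks at a position that keeps the list of block areas sorted in non-increasing order. Let $\Lambda_1,\Lambda_2$ be the two blocks that remain, in this order, with areas $a_1\ge a_2$. If $\operatorname{width}(Q)>\operatorname{height}(Q)$, divide $Q$ by a vertical line into a left piece $Q_1$ of area $a_1$ and a right piece $Q_2$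 of area $a_2$; otherwise divide $Q$ by a horizontal line into a top piece $Q_1$ of area $a_1$ and a bottom piece $Q_2$ of area $a_2$. Apply the algorithm recursively to $(Q_1,\Lambda_1)$ and to $(Q_2,\Lambda_2)$ and return the union of the two results. Ties in sorting and inserting may be broken arbitrarily. **Theorem.** Let $R$ be a rectangle and let $A_1,\dots,A_n>0$ with $\sum_{i=1}^n A_i=\operatorname{Area}(R)$. Then Algorithm ApproximationDC, applied to $R$ and $A_1,\dots,A_n$, produces an output, and, however ties are broken, every output $R_1,\dots,R_n$ is a partition of $R$ with areas $A_1,\dots,A_n$ such that for every partition $R_1',\dots,R_n'$ of $R$ with areas $A_1,\dots,A_n$ $$\sum_{i=1}^n\operatorname{Perim}(R_i)\;\le\;1.203\,\sum_{i=1}^n\operatorname{Perim}(R_i').$$ That is, the total perimeter of the output is at most $1.203$ times the minimum total perimeter over all partitions of $R$ into $n$ sub-rectangles with these areas. -/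

import Mathlib

open scoped BigOperators

noncomputable section

namespace RectPartition

/-- An axis-parallel rectangle in the plane: `(x, y)` is the lower left corner, `w` the width and
`h` the height. -/
@[ext]
structure Rect where
  x : ℝ
  y : ℝ
  w : ℝ
  h : ℝ

namespace Rect

/-- The rectangle has positive width and positive height. -/
def Nondegenerate (Q : Rect) : Prop := 0 < Q.w ∧ 0 < Q.h

/-- The closed region of the plane occupied by the rectangle. -/
def toSet (Q : Rect) : Set (ℝ × ℝ) :=
  Set.Icc Q.x (Q.x + Q.w) ×ˢ Set.Icc Q.y (Q.y + Q.h)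

def area (Q : Rect) : ℝ := Q.w * Q.h

/-- The perimeter, with the normalization `width + height` (half of the boundary length). -/
def perim (Q : Rect) : ℝ := Q.w + Q.h

/-- The left piece, of area `a`, when `Q` is cut by a vertical line. -/
def left (Q : Rect) (a : ℝ) : Rect := ⟨Q.x, Q.y, a / Q.h, Q.h⟩

/-- The right piece when `Q` is cut by a vertical line whose left piece has area `a`. -/
def right (Q : Rect) (a : ℝ) : Rect := ⟨Q.x + a / Q.h, Q.y, Q.w - a / Q.h, Q.h⟩

/-- The top piece, of area `a`, when `Q` is cut by a horizontal line. -/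
def top (Q : Rect) (a : ℝ) : Rect := ⟨Q.x, Q.y + (Q.h - a / Q.w), Q.w, a / Q.w⟩

/-- The bottom piece when `Q` is cut by a horizontal line whose top piece has area `a`. -/
def bottom (Q : Rect) (a : ℝ) : Rect := ⟨Q.x, Q.y, Q.w, Q.h - a / Q.w⟩

end Rect

/-- `P` is a partition of the rectangle `R` into non-degenerate sub-rectangles with prescribed
areas: they have pairwise disjoint interiors, their union is `R`, and the area of `P i` is `A i`. -/
structure IsPartition {n : ℕ} (R : Rect) (A : Fin n → ℝ) (P : Fin n → Rect) : Prop where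
  nondegenerate : ∀ i, (P i).Nondegenerate
  disjoint_interior :
    ∀ i j, i ≠ j → Disjoint (interior (P i).toSet) (interior (P j).toSet)
  iUnion_eq : ⋃ i, (P i).toSet = R.toSet
  area_eq : ∀ i, (P i).area = A i

/-- The total perimeter of all sub-rectangles of `P`. -/
def totalPerim {n : ℕ} (P : Fin n → Rect) : ℝ := ∑ i, (P i).perim

/-! ### The divide and conquer algorithm

The areas are carried by labels `i : Fin n`, label `i` standing for the area `A i`. The algorithm
does not say how ties between equal areas are broken when sorting or inserting; it is described by
a relation which admits every way of breaking ties. -/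

/-- The area of a block, i.e. of a list of labels. -/
def blockArea {n : ℕ} (A : Fin n → ℝ) (B : List (Fin n)) : ℝ := (B.map A).sum

/-- A list of blocks is sorted if the block areas are in non-increasing order. -/
def BlocksSorted {n : ℕ} (A : Fin n → ℝ) (L : List (List (Fin n))) : Prop :=
  L.Pairwise (fun B C => blockArea A C ≤ blockArea A B)

/-- One pass of the bundling loop on a sorted list of blocks: the last two blocks `B`, `C` (the two
smallest ones) are merged, and the merged block is inserted into the remaining list `L₁ ++ L₂` at a
position that keeps the list sorted. -/
inductive BundleStep {n : ℕ} (A : Fin n → ℝ) :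
    List (List (Fin n)) → List (List (Fin n)) → Prop
  | merge (L₁ L₂ : List (List (Fin n))) (B C : List (Fin n))
      (hsorted : BlocksSorted A (L₁ ++ (B ++ C) :: L₂)) :
      BundleStep A (L₁ ++ L₂ ++ [B, C]) (L₁ ++ (B ++ C) :: L₂)

/-- The bundling phase on a list `Λ` of labels: sort the labels by non-increasing area, start with
one block for each label, and repeat the bundling step until exactly two blocks `B₁`, `B₂` are left,
`B₁` being the first one in the sorted list. (A bundling step shortens the list by one, so the loop
is run precisely while more than two blocks are left.) -/
def BundlesTo {n : ℕ} (A : Fin n → ℝ) (Λ B₁ B₂ : List (Fin n)) : Prop :=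
  ∃ S : List (Fin n), S.Perm Λ ∧ S.Pairwise (fun i j => A j ≤ A i) ∧
    Relation.ReflTransGen (BundleStep A) (S.map fun i => [i]) [B₁, B₂]

/-- `Run A P Q Λ`: a complete run of the recursive procedure on the rectangle `Q` and the list `Λ`
of labels, in which each label `i` of `Λ` is assigned the rectangle `P i`. A single label gets the
whole of `Q`. Otherwise the labels are bundled into two blocks; `Q` is cut by a vertical line if its
width exceeds its height (first block on the left) and by a horizontal line if not (first block on
the top), and the procedure is applied to both pieces with their blocks. -/
inductive Run {n : ℕ} (A : Fin n → ℝ) (P : Fin n → Rect) : Rect → List (Fin n) → Prop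
  | single (Q : Rect) (i : Fin n) (h : P i = Q) : Run A P Q [i]
  | vertical (Q : Rect) (Λ B₁ B₂ : List (Fin n)) (hΛ : 2 ≤ Λ.length)
      (hB : BundlesTo A Λ B₁ B₂) (hwh : Q.h < Q.w)
      (h₁ : Run A P (Q.left (blockArea A B₁)) B₁)
      (h₂ : Run A P (Q.right (blockArea A B₁)) B₂) : Run A P Q Λ
  | horizontal (Q : Rect) (Λ B₁ B₂ : List (Fin n)) (hΛ : 2 ≤ Λ.length)
      (hB : BundlesTo A Λ B₁ B₂) (hwh : Q.w ≤ Q.h)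
      (h₁ : Run A P (Q.top (blockArea A B₁)) B₁)
      (h₂ : Run A P (Q.bottom (blockArea A B₁)) B₂) : Run A P Q Λ

/-- `P` is an output of the algorithm `ApproximationDC` on the rectangle `R` and the areas
`A 0, …, A (n - 1)`. -/
def ApproximationDC {n : ℕ} (R : Rect) (A : Fin n → ℝ) (P : Fin n → Rect) : Prop :=
  Run A P R (List.finRange n)

end RectPartition

end

/-! A rectangle of area `a` has perimeter at least `2√a`, so it would be enough to bound the output
by `2.406` times the sum `sig` of the roots of the areas. A rectangle of aspect ratio at most three
costs at most `(4/√3)√a < 2.3095√a`, and this ratio survives a cut parallel to a shorter side if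
both parts get at least a third of the area. In a Huffman tree siblings differ by a factor of at
most two unless the heavier one is a leaf (`Splits.le_two_mul`). The exceptional nodes are the `Bad`
ones: a heavy leaf next to a strip. Their excess (`BadBound`) is paid for by their neighbours, whose
shape the sibling property dictates. The sibling is a pair of comparable leaves, which absorbs the
excess at once, or a leaf; then at most `0.193√a` remains (`Semi`), and the next sibling absorbs it.
`Huff.bounds` proves this by induction, together with `LongBound`, which holds at every aspect ratio
and controls the strips.

On elongated rectangles `2√a` is too weak. There each rectangle of a competing partition has a side
at most the shorter side of `R`, which gives the lower bound `minPerim` and `Huff.thinBound`. A bad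
or semi-bad root has no sibling to pay for it. Here geometry helps: one heavy rectangle forces a
short side on all others (`Packing.short_side`), and two heavy ones either do so too
(`Packing.short_side₂`) or are stacked and have a large perimeter themselves (`Packing.stacked`).
`Huff.cost_le` needs only these lower bounds.

It remains to see that a run follows a Huffman tree although every block is bundled afresh. The
invariant `Coherent` says that rebundling a block repeats the merges that formed it. So the sibling
pairs of the tree are those of one greedy bundling, `huffPairs`, which depends only on the multiset
of areas and not on ties; each of its merges lies above the earlier ones. -/

noncomputable section

namespace RectPartition

/-! ### Huffman trees and the neighbourhood of a bad node. -/

/-- Binary trees with areas at the leaves. -/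
inductive HTree where
  | leaf (a : ℝ) : HTree
  | node (l r : HTree) : HTree

namespace HTree

/-- The sum of `f` over the leaves. -/
def leafSum (f : ℝ → ℝ) : HTree → ℝ
  | leaf a => f a
  | node l r => leafSum f l + leafSum f r

/-- The total area of the leaves. -/
def wt (t : HTree) : ℝ := t.leafSum id

/-- The number of nodes. -/
def size : HTree → ℕ
  | leaf _ => 1
  | node l r => size l + size r + 1

/-- The multiset of leaf areas. -/
def leaves : HTree → Multiset ℝ
  | leaf a => {a}
  | node l r => leaves l + leaves r

/-- The pairs of weights (smaller one first) of siblings. -/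
def pairs : HTree → Multiset (ℝ × ℝ)
  | leaf _ => 0
  | node l r => (min l.wt r.wt, max l.wt r.wt) ::ₘ (pairs l + pairs r)

/-- The total perimeter of the guillotine dissection encoded by the tree, for a rectangle that has
a side `m` and area `t.wt`; each cut is parallel to a shorter side. -/
def cost : HTree → ℝ → ℝ
  | leaf a, m => m + a / m
  | node l r, m =>
      cost l (min m ((node l r).wt / m)) + cost r (min m ((node l r).wt / m))

/-- The sibling property of Huffman trees, with positive leaves. -/
def Huff : HTree → Prop
  | leaf a => 0 < a
  | node l r => Huff l ∧ Huff r ∧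
      (∀ p ∈ pairs l, ∀ q ∈ pairs r, p.2 ≤ q.1 ∨ q.2 ≤ p.1) ∧
      ∀ p ∈ pairs l + pairs r, p.2 ≤ min l.wt r.wt

/-- The children of the root of `t` are `k₁` and `k₂`, in some order. -/
def Splits (t k₁ k₂ : HTree) : Prop := t = node k₁ k₂ ∨ t = node k₂ k₁

/-- A leaf heavier than twice its sibling. -/
def Bad (t : HTree) : Prop := ∃ a s, t.Splits (leaf a) s ∧ 2 * s.wt < a

/-- A bad tree whose sibling is a leaf. -/
def Semi (t : HTree) : Prop := ∃ b x, t.Splits b (leaf x) ∧ b.Bad ∧ x ≤ 2 * b.wt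

/-- Any two siblings differ by a factor of at most two. -/
def Pure (t : HTree) : Prop := ∀ p ∈ t.pairs, p.2 ≤ 2 * p.1

@[simp] lemma leafSum_leaf (f : ℝ → ℝ) (a : ℝ) : (leaf a).leafSum f = f a := rfl

@[simp] lemma leafSum_node (f : ℝ → ℝ) (l r : HTree) :
    (node l r).leafSum f = l.leafSum f + r.leafSum f := rfl

@[simp] lemma wt_leaf (a : ℝ) : (leaf a).wt = a := rfl

@[simp] lemma wt_node (l r : HTree) : (node l r).wt = l.wt + r.wt := rfl

lemma leafSum_eq (f : ℝ → ℝ) (t : HTree) : t.leafSum f = (t.leaves.map f).sum := by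
  induction t with
  | leaf a => simp [leaves]
  | node l r hl hr => simp [leaves, hl, hr]

lemma Splits.symm {t k₁ k₂ : HTree} (h : t.Splits k₁ k₂) : t.Splits k₂ k₁ := Or.symm h

lemma Splits.leafSum {t k₁ k₂ : HTree} (h : t.Splits k₁ k₂) (f : ℝ → ℝ) :
    t.leafSum f = k₁.leafSum f + k₂.leafSum f := by
  rcases h with rfl | rfl
  · rfl
  · exact add_comm _ _

lemma Splits.wt {t k₁ k₂ : HTree} (h : t.Splits k₁ k₂) : t.wt = k₁.wt + k₂.wt := h.leafSum id

lemma Splits.leaves {t k₁ k₂ : HTree} (h : t.Splits k₁ k₂) :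
    t.leaves = k₁.leaves + k₂.leaves := by
  rcases h with rfl | rfl
  · rfl
  · exact add_comm _ _

lemma Splits.size_lt {t k₁ k₂ : HTree} (h : t.Splits k₁ k₂) : k₁.size < t.size := by
  rcases h with rfl | rfl <;> simp only [HTree.size] <;> omega

lemma Splits.pairs {t k₁ k₂ : HTree} (h : t.Splits k₁ k₂) :
    t.pairs = (min k₁.wt k₂.wt, max k₁.wt k₂.wt) ::ₘ (k₁.pairs + k₂.pairs) := by
  rcases h with rfl | rfl
  · rfl
  · rw [min_comm k₁.wt, max_comm k₁.wt, add_comm k₁.pairs]; rfl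

lemma Splits.huff {t k₁ k₂ : HTree} (h : t.Splits k₁ k₂) (ht : t.Huff) :
    k₁.Huff ∧ k₂.Huff ∧ (∀ p ∈ k₁.pairs, ∀ q ∈ k₂.pairs, p.2 ≤ q.1 ∨ q.2 ≤ p.1) ∧
      ∀ p ∈ k₁.pairs + k₂.pairs, p.2 ≤ min k₁.wt k₂.wt := by
  rcases h with rfl | rfl
  · exact ht
  · obtain ⟨h1, h2, h3, h4⟩ := ht
    refine ⟨h2, h1, fun p hp q hq => (h3 q hq p hp).symm, fun p hp => ?_⟩
    rw [min_comm]
    exact h4 p (by rwa [add_comm])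

lemma exists_splits (t : HTree) : (∃ a, t = leaf a) ∨ ∃ k₁ k₂, t.Splits k₁ k₂ := by
  cases t with
  | leaf a => exact Or.inl ⟨a, rfl⟩
  | node l r => exact Or.inr ⟨l, r, Or.inl rfl⟩

lemma Huff.wt_pos {t : HTree} (ht : t.Huff) : 0 < t.wt := by
  induction t with
  | leaf a => exact ht
  | node l r hl hr => exact add_pos (hl ht.1) (hr ht.2.1)

lemma cost_leaf (a m : ℝ) : (leaf a).cost m = m + a / m := rfl

/-- `m` and `t.wt / m` are the two sides of the rectangle, and `cost` uses only the smaller one. So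
either side may serve as the argument. -/
lemma cost_swap {t : HTree} (ht : 0 < t.wt) {m : ℝ} (hm : 0 < m) :
    t.cost (t.wt / m) = t.cost m := by
  have e : t.wt / (t.wt / m) = m := by field_simp
  cases t with
  | leaf a =>
    rw [wt_leaf] at e
    rw [wt_leaf, cost_leaf, cost_leaf, e, add_comm]
  | node l r => simp only [cost, e, min_comm]

lemma Splits.cost {t k₁ k₂ : HTree} (h : t.Splits k₁ k₂) {m : ℝ} (hm : 0 < m)
    (hS : m ^ 2 ≤ t.wt) : t.cost m = k₁.cost m + k₂.cost m := by
  have e : min m (t.wt / m) = m := min_eq_left (by rw [le_div_iff₀ hm]; nlinarith)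
  rcases h with rfl | rfl
  · simp only [HTree.cost, e]
  · simp only [HTree.cost, e]; exact add_comm _ _

/-- In a Huffman tree which is not bad, siblings at the root differ by a factor of at most two. -/
lemma Splits.le_two_mul {t k₁ k₂ : HTree} (h : t.Splits k₁ k₂) (ht : t.Huff) (hb : ¬ t.Bad) :
    k₁.wt ≤ 2 * k₂.wt := by
  by_contra! hlt
  rcases k₁.exists_splits with ⟨a, rfl⟩ | ⟨p, q, hpq⟩
  · exact hb ⟨a, k₂, h, hlt⟩
  -- If `k₁` is not a leaf, both of its children are at most `k₂`, whence `k₁` is at most twice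
  -- `k₂`.
  · have h4 := (h.huff ht).2.2.2 (min p.wt q.wt, max p.wt q.wt)
      (by rw [hpq.pairs]; simp)
    have h5 := h4.trans (min_le_right _ _)
    have := hpq.wt
    have := le_max_left p.wt q.wt
    have := le_max_right p.wt q.wt
    simp only at h5
    linarith

lemma Splits.bad_pair {b s : HTree} {a : ℝ} (h : b.Splits (leaf a) s) (hb : b.Huff)
    (hs : 2 * s.wt < a) : (s.wt, a) ∈ b.pairs ∧ 0 < s.wt := by
  have hs0 : 0 < s.wt := (h.huff hb).2.1.wt_pos
  rw [h.pairs, wt_leaf, min_eq_right (by linarith), max_eq_left (by linarith)]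
  exact ⟨Multiset.mem_cons_self _ _, hs0⟩

/-- The sibling of a bad tree is a leaf or has two leaves of comparable size. -/
lemma sibling_of_bad {t b y s : HTree} {a : ℝ} (ht : t.Huff) (h : t.Splits b y)
    (hb : b.Splits (leaf a) s) (hs : 2 * s.wt < a) (hy : ∀ x, y ≠ leaf x) :
    ∃ x₁ x₂, y.Splits (leaf x₁) (leaf x₂) ∧ x₂ ≤ x₁ ∧ a ≤ x₂ ∧ x₁ ≤ b.wt := by
  obtain ⟨hbH, hyH, hcomp, htop⟩ := h.huff ht
  obtain ⟨hmem, hs0⟩ := hb.bad_pair hbH hs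
  have hbw := hb.wt
  rw [wt_leaf] at hbw
  obtain ⟨y₁, y₂, hy12, hle⟩ : ∃ y₁ y₂, y.Splits y₁ y₂ ∧ y₂.wt ≤ y₁.wt := by
    rcases y.exists_splits with ⟨x, rfl⟩ | ⟨y₁, y₂, h12⟩
    · exact absurd rfl (hy x)
    · rcases le_total y₂.wt y₁.wt with h' | h'
      · exact ⟨_, _, h12, h'⟩
      · exact ⟨_, _, h12.symm, h'⟩
  have hyp := hy12.pairs
  rw [min_eq_right hle, max_eq_left hle] at hyp
  have hyw := hy12.wt
  have hmy : (y₂.wt, y₁.wt) ∈ y.pairs := by rw [hyp]; exact Multiset.mem_cons_self _ _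
  have h1 : a ≤ y.wt :=
    (htop _ (Multiset.mem_add.2 (Or.inl hmem))).trans (min_le_right _ _)
  have h2 : y₁.wt ≤ b.wt :=
    (htop _ (Multiset.mem_add.2 (Or.inr hmy))).trans (min_le_left _ _)
  -- The pairs `(s, a)` and `(y₂, y₁)` are comparable. Were `y₁ ≤ s`, then `y ≤ 2s < a`, against `a
  -- ≤ y`.
  have h3 : a ≤ y₂.wt := by
    rcases hcomp _ hmem _ hmy with h' | h'
    · exact h'
    · simp only at h'; linarith
  -- If such a `z` had children, comparing them with `(s, a)` would give `z ≥ 2a > a + s = b` or `z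
  -- ≤ 2s < a`.
  have key : ∀ z ∈ [y₁, y₂], ∃ x, z = leaf x := by
    intro z hz
    have hz1 : a ≤ z.wt ∧ z.wt ≤ b.wt ∧ ∀ p ∈ z.pairs, p ∈ y.pairs := by
      simp only [List.mem_cons, List.not_mem_nil, or_false] at hz
      rcases hz with rfl | rfl
      · exact ⟨h3.trans hle, h2, fun p hp => by rw [hyp]; simp [hp]⟩
      · exact ⟨h3, hle.trans h2, fun p hp => by rw [hyp]; simp [hp]⟩
    rcases z.exists_splits with ⟨x, rfl⟩ | ⟨z₁, z₂, hz12⟩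
    · exact ⟨x, rfl⟩
    · exfalso
      have hzw := hz12.wt
      have hmz : (min z₁.wt z₂.wt, max z₁.wt z₂.wt) ∈ y.pairs :=
        hz1.2.2 _ (by rw [hz12.pairs]; exact Multiset.mem_cons_self _ _)
      rcases hcomp _ hmem _ hmz with h' | h'
      · simp only [le_min_iff] at h'; linarith
      · simp only [max_le_iff] at h'; linarith
  obtain ⟨x₁, rfl⟩ := key y₁ (by simp)
  obtain ⟨x₂, rfl⟩ := key y₂ (by simp)
  exact ⟨x₁, x₂, hy12, hle, h3, h2⟩

/-- No pair straddles the gap between `s` and `a`, and a node of weight at least `a` cannot have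
both children at most `s`, since `2s < a`. So weights at least `a` propagate from the root to the
leaves. -/
lemma le_of_pairs_gap {a s : ℝ} (hs : 2 * s < a) {t : HTree}
    (hp : ∀ p ∈ t.pairs, p.2 ≤ s ∨ a ≤ p.1) (ht : a ≤ t.wt) :
    (∀ x ∈ t.leaves, a ≤ x) ∧ ∀ p ∈ t.pairs, a ≤ p.1 := by
  induction t with
  | leaf x => simpa [leaves, pairs] using ht
  | node l r hl hr =>
    have h0 : a ≤ min l.wt r.wt := by
      rcases hp _ (Multiset.mem_cons_self _ _) with h' | h'
      · simp only [max_le_iff] at h'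
        rw [wt_node] at ht
        linarith
      · exact h'
    rw [le_min_iff] at h0
    obtain ⟨h1, h2⟩ := hl (fun p hp' => hp p (by simp [pairs, hp'])) h0.1
    obtain ⟨h3, h4⟩ := hr (fun p hp' => hp p (by simp [pairs, hp'])) h0.2
    refine ⟨fun x hx => ?_, fun p hx => ?_⟩
    · rw [leaves, Multiset.mem_add] at hx
      exact hx.elim (h1 x) (h3 x)
    · rw [pairs, Multiset.mem_cons, Multiset.mem_add] at hx
      rcases hx with rfl | hx | hx
      · exact le_min h0.1 h0.2
      · exact h2 p hx
      · exact h4 p hx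

lemma Semi.bounds {q b s : HTree} {a x : ℝ} (hq : q.Huff) (h : q.Splits b (leaf x))
    (hb : b.Splits (leaf a) s) (hs : 2 * s.wt < a) : a ≤ x := by
  obtain ⟨hbH, -, -, htop⟩ := h.huff hq
  exact (htop _ (Multiset.mem_add.2 (Or.inl (hb.bad_pair hbH hs).1))).trans (min_le_right _ _)

/-- Siblings of a tree consisting of a bad tree and a leaf. -/
lemma sibling_of_semi {t q b y s : HTree} {a x : ℝ} (ht : t.Huff) (h : t.Splits q y)
    (hq : q.Splits b (leaf x)) (hb : b.Splits (leaf a) s) (hs : 2 * s.wt < a) :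
    max b.wt x ≤ y.wt ∧ y.Pure ∧ ∀ z ∈ y.leaves, a ≤ z := by
  obtain ⟨hqH, hyH, hcomp, htop⟩ := h.huff ht
  obtain ⟨hbH, -, -, htopq⟩ := hq.huff hqH
  obtain ⟨hmem, hs0⟩ := hb.bad_pair hbH hs
  have hax := Semi.bounds hqH hq hb hs
  have hbw := hb.wt
  rw [wt_leaf] at hbw
  have hqw := hq.wt
  rw [wt_leaf] at hqw
  have hm1 : (s.wt, a) ∈ q.pairs := by rw [hq.pairs]; simp [hmem]
  have hm2 : (min b.wt x, max b.wt x) ∈ q.pairs := by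
    rw [hq.pairs]; exact Multiset.mem_cons_self _ _
  have h2 : max b.wt x ≤ y.wt :=
    (htop _ (Multiset.mem_add.2 (Or.inl hm2))).trans (min_le_right _ _)
  obtain ⟨h3, h4⟩ := le_of_pairs_gap hs (t := y) (fun p hp => (hcomp _ hm1 _ hp).symm)
    ((hax.trans (le_max_right _ _)).trans h2)
  refine ⟨h2, fun p hp => ?_, h3⟩
  have h5 := h4 p hp
  -- A pair above `(b, x)` has its larger entry at most `q = b + x`, hence at most twice its smaller
  -- one. A pair below has its larger entry at most `b = a + s < 2a`, while its smaller one is at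
  -- least `a`.
  rcases hcomp _ hm2 _ hp with h' | h'
  · have h6 := (htop _ (Multiset.mem_add.2 (Or.inr hp))).trans (min_le_left _ _)
    simp only [max_le_iff] at h'
    linarith
  · simp only [le_min_iff] at h'
    linarith

end HTree

/-! ### Inequalities between real numbers -/

/-- A convexity argument: a bound on `K / h + L * h` need only be checked at end points. -/
lemma div_add_mul_le_of_endpoints {K L R h h₀ h₁ : ℝ} (hL : 0 ≤ L) (h0 : 0 < h₀) (h01 : h₀ ≤ h)
    (h12 : h ≤ h₁) (e₀ : K + L * h₀ ^ 2 ≤ R * h₀) (e₁ : K + L * h₁ ^ 2 ≤ R * h₁) :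
    K / h + L * h ≤ R := by
  have hh : 0 < h := h0.trans_le h01
  -- After multiplication by `h` the difference of the two sides is a convex quadratic in `h`,
  -- whatever the sign of `K`.
  have key : K + L * h ^ 2 ≤ R * h := by
    rcases eq_or_lt_of_le (h01.trans h12) with heq | hlt
    · have : h = h₀ := le_antisymm (h12.trans heq.ge) h01
      rw [this]; exact e₀
    · have h3 : 0 ≤ L * ((h - h₀) * (h₁ - h) * (h₁ - h₀)) :=
        mul_nonneg hL (mul_nonneg (mul_nonneg (sub_nonneg.2 h01) (sub_nonneg.2 h12))
          (sub_nonneg.2 hlt.le))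
      have h4 := mul_le_mul_of_nonneg_right e₀ (sub_nonneg.2 h12)
      have h5 := mul_le_mul_of_nonneg_right e₁ (sub_nonneg.2 h01)
      have h6 : 0 ≤ (R * h - (K + L * h ^ 2)) * (h₁ - h₀) := by nlinarith
      have h7 := nonneg_of_mul_nonneg_left h6 (sub_pos.2 hlt)
      linarith
  rw [div_add' _ _ _ hh.ne', div_le_iff₀ hh]
  nlinarith

/-- The square root lies above its chords. -/
lemma chord_le {u l r : ℝ} (hl : l ≤ u) (hr : u ≤ r) : u ^ 2 + l * r ≤ (l + r) * u := by
  nlinarith [mul_nonneg (sub_nonneg.2 hl) (sub_nonneg.2 hr)]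

/-- With `p`, `a`, `d` the roots of the areas of a bad tree, its heavy leaf and its strip, this
reduces to `4.146 (p - a) ≤ 0.2 d²/m + 1.206 d`. It holds because `p - a = d²/(p + a)` is of second
order in `d`. The constants `1.74` and `4.146 = 2.406 + 1.74` are nearly as large as it allows. -/
lemma bad_bound_real {p a d m : ℝ} (ha : 0 < a) (hap : a ≤ p) (h23 : 2 * p ^ 2 ≤ 3 * a ^ 2)
    (hd0 : 0 ≤ d) (hd : d ^ 2 = p ^ 2 - a ^ 2) (hm : 0 < m) (hmp : m ≤ p) :
    a ^ 2 / m + 2 * m - 2.406 * a + 0.8 * (d ^ 2 / m) - 1.206 * d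
      ≤ p ^ 2 / m + 2 * m - 4.146 * p + 1.74 * a := by
  have hp : 0 < p := ha.trans_le hap
  have h1 : 0.8164 * p ≤ a := by
    by_contra! h
    nlinarith
  have h2 : d ≤ 0.579 * p := by
    by_contra! h
    nlinarith
  have h3 : 1.8164 * p * (p - a) ≤ d ^ 2 := by
    rw [hd]; nlinarith [mul_nonneg (sub_nonneg.2 h1) (sub_nonneg.2 hap)]
  have h4 : 4.146 * (p - a) * p ≤ (0.2 * (d ^ 2 / p) + 1.206 * d) * p := by
    have : d ^ 2 / p * p = d ^ 2 := by field_simp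
    nlinarith [mul_nonneg hd0 (sub_nonneg.2 h2), mul_nonneg hd0 hp.le]
  have h5 := le_of_mul_le_mul_right h4 hp
  have h6 : d ^ 2 / p ≤ d ^ 2 / m := div_le_div_of_nonneg_left (sq_nonneg d) hm hmp
  have h7 : p ^ 2 / m = a ^ 2 / m + d ^ 2 / m := by rw [hd]; ring
  rw [h7]
  linarith

/-- The two regimes for the direction `(C, s)` of the square roots of the areas of a bad tree and
of the leaf next to it, with the coefficient `α` that belongs to the direction. -/
def Regime (C s α lo : ℝ) : Prop :=
  (C ≤ s ∧ s ^ 2 ≤ 2 * C ^ 2 ∧ α = 2.406 * (C + s) ∧ lo = s) ∨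
  (s ≤ C ∧ 2 * C ^ 2 ≤ 3 * s ^ 2 ∧ α = 4.146 * C + 0.666 * s ∧ lo = C)

lemma Regime.estimate {C s α lo : ℝ} (hC : 0 < C) (hs : 0 < s) (h1 : C ^ 2 + s ^ 2 = 1)
    (h : Regime C s α lo) :
    (∃ e, 0 ≤ e ∧ e ≤ 1 / 6 ∧ C ^ 2 = 1 / 2 - e ∧ lo ^ 2 = 1 / 2 + e ∧ 0.7071 + 0.656 * e ≤ lo ∧
      2.406 * (1.4142 - 0.1225 * e) ≤ α) ∨
    (∃ e, 0 ≤ e ∧ e ≤ 1 / 10 ∧ C ^ 2 = 1 / 2 + e ∧ lo ^ 2 = 1 / 2 + e ∧ 0.7071 + 0.674 * e ≤ lo ∧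
      3.4025 + 2.297 * e ≤ α) := by
  rcases h with ⟨hCs, h2, rfl, rfl⟩ | ⟨hCs, h2, rfl, rfl⟩
  · left
    have s0 : 0.707106 ≤ lo := by nlinarith
    have s1 : lo ≤ 0.816497 := by nlinarith
    have c0 : 0.57735 ≤ C := by nlinarith
    have c1 : C ≤ 0.707107 := by nlinarith
    have hs' := chord_le s0 s1
    have hc' := chord_le c0 c1
    refine ⟨1 / 2 - C ^ 2, by nlinarith, by nlinarith, by ring, by linarith, ?_, ?_⟩
    · nlinarith
    · have a1 : 0.7071 + 0.6562 * (1 / 2 - C ^ 2) ≤ lo := by nlinarith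
      have a2 : 0.7071 - 0.7786 * (1 / 2 - C ^ 2) ≤ C := by nlinarith
      nlinarith
  · right
    have s0 : 0.632455 ≤ s := by nlinarith
    have s1 : s ≤ 0.707107 := by nlinarith
    have c0 : 0.707106 ≤ lo := by nlinarith
    have c1 : lo ≤ 0.774597 := by nlinarith
    have hs' := chord_le s0 s1
    have hc' := chord_le c0 c1
    have a1 : 0.7071 + 0.6748 * (lo ^ 2 - 1 / 2) ≤ lo := by nlinarith
    have a2 : 0.7071 - 0.7466 * (lo ^ 2 - 1 / 2) ≤ s := by nlinarith
    refine ⟨lo ^ 2 - 1 / 2, by nlinarith, by nlinarith, by ring, by ring, ?_, ?_⟩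
    · nlinarith
    · nlinarith

/-- The next lemma takes its chords for `u` and `v` between `1/√3` and `√(2/3)`, whose sum and
product are about `1.393847` and `0.471404`. -/
lemma Regime.chords {C s α lo u v : ℝ} (hC : 0 < C) (hs : 0 < s)
    (h1 : C ^ 2 + s ^ 2 = 1) (h : Regime C s α lo) (hu : 0 < u) (hv : 0 < v)
    (huv : u ^ 2 + v ^ 2 = 1) (hvlo : u * lo ≤ v) (hvu : v ^ 2 ≤ 2 * u ^ 2) : u ^ 2 * (1 + lo ^ 2) ≤ 1 ∧ 1 / 3 ≤ u ^ 2 ∧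
    u ^ 2 + 0.471404 ≤ 1.393847 * u ∧ 1.471404 - u ^ 2 ≤ 1.393847 * v := by
  have hlo : 0.7071 ≤ lo ∧ 1 / 2 ≤ lo ^ 2 := by
    rcases h.estimate hC hs h1 with ⟨e, h0, -, -, h3, h4, -⟩ | ⟨e, h0, -, -, h3, h4, -⟩
    · exact ⟨by linarith, by linarith⟩
    · exact ⟨by linarith, by linarith⟩
  have hA : u ^ 2 * lo ^ 2 ≤ v ^ 2 := by
    rw [← mul_pow]
    exact pow_le_pow_left₀ (mul_nonneg hu.le (by linarith)) hvlo 2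
  have u0 : 0.57735 ≤ u := by nlinarith
  have hu23 : u ^ 2 ≤ 2 / 3 := by nlinarith [sq_nonneg u]
  have u1 : u ≤ 0.816497 := by nlinarith
  have v0 : 0.57735 ≤ v := by nlinarith
  have v1 : v ≤ 0.816497 := by nlinarith
  have hu' := chord_le u0 u1
  have hv' := chord_le v0 v1
  refine ⟨by linarith, by linarith, by nlinarith, by nlinarith⟩

/-- The case of a square in `bad_leaf_leaf_real`, scaled by the side: there `u`, `v` are the roots
of the shares of the semi-bad tree and of the last leaf. -/
lemma Regime.square_end {C s α lo u v : ℝ} (hC : 0 < C) (hs : 0 < s)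
    (h1 : C ^ 2 + s ^ 2 = 1) (h : Regime C s α lo) (hu : 0 < u) (hv : 0 < v)
    (huv : u ^ 2 + v ^ 2 = 1) (hvlo : u * lo ≤ v) (hvu : v ^ 2 ≤ 2 * u ^ 2) : 3 + u ^ 2 + C ^ 2 ≤ u * α + 2.406 * v := by
  obtain ⟨hθ, hθ3, hu', hv'⟩ := Regime.chords hC hs h1 h hu hv huv hvlo hvu
  set θ := u ^ 2 with hθdef
  rcases h.estimate hC hs h1 with ⟨e, h0, he, hCe, hle, -, hα⟩ | ⟨e, h0, he, hCe, hle, -, hα⟩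
  · rw [hle] at hθ
    have hα0 : 0 ≤ α := by linarith
    have h3 : α * (θ + 0.471404) ≤ 1.393847 * (u * α) := by
      linarith [mul_le_mul_of_nonneg_left hu' hα0]
    have h4 : 2.406 * (1.4142 - 0.1225 * e) * (θ + 0.471404) ≤ α * (θ + 0.471404) :=
      mul_le_mul_of_nonneg_right hα (by linarith)
    have h5 : 0 ≤ e * θ := mul_nonneg h0 (by linarith)
    have h6 : θ ≤ 2 / 3 := by linarith
    have h7 : 0 ≤ e * (2 / 3 - θ) := mul_nonneg h0 (by linarith)
    rw [hCe]
    linarith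
  · rw [hle] at hθ
    have hα0 : 0 ≤ α := by linarith
    have h3 : α * (θ + 0.471404) ≤ 1.393847 * (u * α) := by
      linarith [mul_le_mul_of_nonneg_left hu' hα0]
    have h4 : (3.4025 + 2.297 * e) * (θ + 0.471404) ≤ α * (θ + 0.471404) :=
      mul_le_mul_of_nonneg_right hα (by linarith)
    have h5 : 0 ≤ e * (θ - 1 / 3) := mul_nonneg h0 (by linarith)
    have h6 : θ ≤ 2 / 3 := by linarith
    have h7 : 0 ≤ e * (2 / 3 - θ) := mul_nonneg h0 (by linarith)
    rw [hCe]
    linarith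

/-- The case of aspect ratio three in `bad_leaf_leaf_real`; `1.73206` stands for `√3`. -/
lemma Regime.thin_end {C s α lo u v : ℝ} (hC : 0 < C) (hs : 0 < s)
    (h1 : C ^ 2 + s ^ 2 = 1) (h : Regime C s α lo) (hu : 0 < u) (hv : 0 < v)
    (huv : u ^ 2 + v ^ 2 = 1) (hvlo : u * lo ≤ v) (hvu : v ^ 2 ≤ 2 * u ^ 2) : 1.73206 * (2 + u ^ 2 * C ^ 2) ≤ u * α + 2.406 * v := by
  obtain ⟨hθ, hθ3, hu', hv'⟩ := Regime.chords hC hs h1 h hu hv huv hvlo hvu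
  set θ := u ^ 2 with hθdef
  rcases h.estimate hC hs h1 with ⟨e, h0, he, hCe, hle, -, hα⟩ | ⟨e, h0, he, hCe, hle, -, hα⟩
  · rw [hle] at hθ
    have hα0 : 0 ≤ α := by linarith
    have h3 : α * (θ + 0.471404) ≤ 1.393847 * (u * α) := by
      linarith [mul_le_mul_of_nonneg_left hu' hα0]
    have h4 : 2.406 * (1.4142 - 0.1225 * e) * (θ + 0.471404) ≤ α * (θ + 0.471404) :=
      mul_le_mul_of_nonneg_right hα (by linarith)
    have h5 : 0 ≤ e * θ := mul_nonneg h0 (by linarith)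
    have h6 : θ ≤ 2 / 3 := by linarith
    have h7 : 0 ≤ e * (2 / 3 - θ) := mul_nonneg h0 (by linarith)
    rw [hCe]
    linarith
  · rw [hle] at hθ
    have hα0 : 0 ≤ α := by linarith
    have h3 : α * (θ + 0.471404) ≤ 1.393847 * (u * α) := by
      linarith [mul_le_mul_of_nonneg_left hu' hα0]
    have h4 : (3.4025 + 2.297 * e) * (θ + 0.471404) ≤ α * (θ + 0.471404) :=
      mul_le_mul_of_nonneg_right hα (by linarith)
    have h5 : 0 ≤ e * (θ - 1 / 3) := mul_nonneg h0 (by linarith)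
    have h6 : θ ≤ 2 / 3 := by linarith
    have h7 : 0 ≤ e * (2 / 3 - θ) := mul_nonneg h0 (by linarith)
    rw [hCe]
    linarith

/-- The case in `bad_leaf_leaf_real` where the piece of the semi-bad tree is a square, so that its
cutting direction changes. -/
lemma Regime.middle {C s α lo τ : ℝ} (hC : 0 < C) (hs : 0 < s)
    (h1 : C ^ 2 + s ^ 2 = 1) (h : Regime C s α lo) (hτ0 : lo ≤ τ) (hτ : τ ^ 2 ≤ 2) :
    4 + C ^ 2 + τ ^ 2 ≤ α + 2.406 * τ := by
  have hτ1 : τ ≤ 1.41422 := by nlinarith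
  have hch := chord_le hτ0 hτ1
  rcases h.estimate hC hs h1 with ⟨e, h0, he, hCe, hle, hlo, hα⟩ | ⟨e, h0, he, hCe, hle, hlo, hα⟩
  · have : lo ≤ 0.8166 := by nlinarith
    nlinarith
  · have : lo ≤ 0.7747 := by nlinarith
    nlinarith

lemma le_of_sq_le {a b : ℝ} (h : a ^ 2 ≤ b ^ 2) (hb : 0 ≤ b) : a ≤ b :=
  (abs_le_of_sq_le_sq' h hb).2

lemma div_sqrt_three_bounds {T : ℝ} (hT : 0 < T) :
    0 < T / √3 ∧ (T / √3) ^ 2 = T ^ 2 / 3 ∧ T ≤ 1.73206 * (T / √3) := by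
  have h3 : (0 : ℝ) < √3 := Real.sqrt_pos.2 (by norm_num)
  have h4 : √3 ≤ 1.73206 := Real.sqrt_le_iff.2 ⟨by norm_num, by norm_num⟩
  refine ⟨by positivity, ?_, ?_⟩
  · rw [div_pow, Real.sq_sqrt (by norm_num)]
  · rw [← mul_div_assoc, le_div_iff₀ h3]
    nlinarith

/-- The numerical estimate behind a bad tree, a leaf next to it, and a leaf next to both. -/
lemma bad_leaf_leaf_real {p x y a h : ℝ} (ha : 0 < a) (hh : 0 < h) (hap : a ≤ p) (hax : a ≤ x)
    (hpy : p ≤ y) (hxy : x ≤ y) (h23 : 2 * p ^ 2 ≤ 3 * a ^ 2) (hx : x ^ 2 ≤ 2 * p ^ 2)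
    (hy : y ^ 2 ≤ 2 * (p ^ 2 + x ^ 2)) (hS : h ^ 2 ≤ p ^ 2 + x ^ 2 + y ^ 2)
    (hS3 : p ^ 2 + x ^ 2 + y ^ 2 ≤ 3 * h ^ 2) :
    (p ^ 2 + x ^ 2 ≤ h ^ 2 →
      (2 * (p ^ 2 + x ^ 2) + y ^ 2) / h + (2 + p ^ 2 / (p ^ 2 + x ^ 2)) * h
        ≤ 2.406 * (x + y) + 4.146 * p - 1.74 * a) ∧
    (h ^ 2 ≤ p ^ 2 + x ^ 2 →
      (2 * p ^ 2 + x ^ 2 + y ^ 2) / h + 3 * h ≤ 2.406 * (x + y) + 4.146 * p - 1.74 * a) := by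
  have hp : 0 < p := by linarith
  have hx0 : 0 < x := by linarith
  have hy0 : 0 < y := by linarith
  obtain ⟨Q, hQ, hQ2⟩ : ∃ Q, 0 < Q ∧ Q ^ 2 = p ^ 2 + x ^ 2 :=
    ⟨√(p ^ 2 + x ^ 2), Real.sqrt_pos.2 (by positivity), Real.sq_sqrt (by positivity)⟩
  obtain ⟨T, hT, hT2⟩ : ∃ T, 0 < T ∧ T ^ 2 = Q ^ 2 + y ^ 2 :=
    ⟨√(Q ^ 2 + y ^ 2), Real.sqrt_pos.2 (by positivity), Real.sq_sqrt (by positivity)⟩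
  set R := 2.406 * (x + y) + 4.146 * p - 1.74 * a with hR
  obtain ⟨C, hC⟩ : ∃ C, C = p / Q := ⟨_, rfl⟩
  obtain ⟨s, hs⟩ : ∃ s, s = x / Q := ⟨_, rfl⟩
  obtain ⟨u, hu⟩ : ∃ u, u = Q / T := ⟨_, rfl⟩
  obtain ⟨v, hv⟩ : ∃ v, v = y / T := ⟨_, rfl⟩
  have hpC : p = C * Q := by rw [hC]; field_simp
  have hxs : x = s * Q := by rw [hs]; field_simp
  have hQu : Q = u * T := by rw [hu]; field_simp
  have hyv : y = v * T := by rw [hv]; field_simp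
  have hC0 : 0 < C := by rw [hC]; positivity
  have hs0 : 0 < s := by rw [hs]; positivity
  have hu0 : 0 < u := by rw [hu]; positivity
  have hv0 : 0 < v := by rw [hv]; positivity
  have hCs : C ^ 2 + s ^ 2 = 1 := by
    rw [hC, hs, div_pow, div_pow, ← add_div, ← hQ2]; field_simp
  have huv : u ^ 2 + v ^ 2 = 1 := by
    rw [hu, hv, div_pow, div_pow, ← add_div, ← hT2]; field_simp
  -- The variable `a` is eliminated through the sharper of `a ≤ p` and `a ≤ x`; this choice is what
  -- the two regimes are.
  obtain ⟨α, lo, hreg, hαR, hlo⟩ : ∃ α lo, Regime C s α lo ∧ α * Q + 2.406 * y ≤ R ∧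
      lo * Q ≤ y := by
    rcases le_total p x with hpx | hpx
    · refine ⟨2.406 * (C + s), s, Or.inl ⟨?_, ?_, rfl, rfl⟩, ?_, by linarith⟩
      · rw [hC, hs]; gcongr
      · rw [hC, hs, div_pow, div_pow, ← mul_div_assoc]; gcongr
      · have : 2.406 * (C + s) * Q = 2.406 * (p + x) := by rw [hpC, hxs]; ring
        rw [this]; linarith
    · refine ⟨4.146 * C + 0.666 * s, C, Or.inr ⟨?_, ?_, rfl, rfl⟩, ?_, by linarith⟩
      · rw [hC, hs]; gcongr
      · rw [hC, hs, div_pow, div_pow, ← mul_div_assoc, ← mul_div_assoc]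
        gcongr ?_ / _
        nlinarith
      · have : (4.146 * C + 0.666 * s) * Q = 4.146 * p + 0.666 * x := by rw [hpC, hxs]; ring
        rw [this]; linarith
  have hvlo : u * lo ≤ v := by
    rw [hu, hv, div_mul_eq_mul_div]; gcongr; linarith
  have hvu : v ^ 2 ≤ 2 * u ^ 2 := by
    rw [hu, hv, div_pow, div_pow, ← mul_div_assoc]; gcongr; rw [hQ2]; exact hy
  have hαT : (u * α + 2.406 * v) * T ≤ R := by
    have : (u * α + 2.406 * v) * T = α * Q + 2.406 * y := by rw [hQu, hyv]; ring
    rw [this]; exact hαR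
  have e1 : (2 * Q ^ 2 + y ^ 2) + (2 + p ^ 2 / Q ^ 2) * T ^ 2 ≤ R * T := by
    have h1 := Regime.square_end hC0 hs0 hCs hreg hu0 hv0 huv hvlo hvu
    have h2 : (2 * Q ^ 2 + y ^ 2) + (2 + p ^ 2 / Q ^ 2) * T ^ 2 = (3 + u ^ 2 + C ^ 2) * T ^ 2 := by
      have : p ^ 2 / Q ^ 2 = C ^ 2 := by rw [hC, div_pow]
      rw [this]
      have : Q ^ 2 = u ^ 2 * T ^ 2 := by rw [hQu]; ring
      linarith
    rw [h2]
    linarith [mul_le_mul_of_nonneg_right h1 (sq_nonneg T), mul_le_mul_of_nonneg_right hαT hT.le]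
  have e2 : 4 * Q ^ 2 + p ^ 2 + y ^ 2 ≤ R * Q := by
    have hτ : (y / Q) ^ 2 ≤ 2 := by
      rw [div_pow, div_le_iff₀ (by positivity), hQ2]; exact hy
    have h1 := Regime.middle hC0 hs0 hCs hreg ((le_div_iff₀ hQ).2 hlo) hτ
    have h2 : y = y / Q * Q := by field_simp
    have h3 : 4 * Q ^ 2 + p ^ 2 + y ^ 2 = (4 + C ^ 2 + (y / Q) ^ 2) * Q ^ 2 := by
      rw [hpC]; nth_rw 1 [h2]; ring
    have h4 : (α + 2.406 * (y / Q)) * Q = α * Q + 2.406 * y := by field_simp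
    rw [h3]
    have h5 := mul_le_mul_of_nonneg_right h1 (sq_nonneg Q)
    have h6 := mul_le_mul_of_nonneg_right hαR hQ.le
    rw [← h4] at h6
    linarith
  have e3 : (2 * T ^ 2 + p ^ 2) * 1.73206 ≤ R * T := by
    have h1 := Regime.thin_end hC0 hs0 hCs hreg hu0 hv0 huv hvlo hvu
    have h2 : (2 * T ^ 2 + p ^ 2) = (2 + u ^ 2 * C ^ 2) * T ^ 2 := by
      rw [hpC, hQu]; ring
    rw [h2]
    linarith [mul_le_mul_of_nonneg_right h1 (sq_nonneg T), mul_le_mul_of_nonneg_right hαT hT.le]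
  have hR0 : 0 ≤ R := by rw [hR]; linarith
  rw [← hQ2]
  constructor
  · intro hQh
    refine div_add_mul_le_of_endpoints (by positivity) hQ (le_of_sq_le hQh hh.le)
      (h₁ := T) ?_ ?_ e1
    · exact le_of_sq_le (by linarith) hT.le
    · have : p ^ 2 / Q ^ 2 * Q ^ 2 = p ^ 2 := by field_simp
      linarith
  · intro hhQ
    obtain ⟨t1, t2, t3⟩ := div_sqrt_three_bounds hT
    refine div_add_mul_le_of_endpoints (by norm_num) t1
      (le_of_sq_le (by linarith) hh.le) (h₁ := Q) ?_ ?_ ?_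
    · exact (le_of_sq_le (by linarith) hQ.le)
    · have h5 := mul_le_mul_of_nonneg_left t3 hR0
      rw [t2]
      linarith
    · linarith

/-- The numerical estimate behind a bad tree and a leaf next to it. -/
lemma bad_leaf_real {p x a h : ℝ} (ha : 0 < a) (hh : 0 < h) (hap : a ≤ p) (hax : a ≤ x)
    (h23 : 2 * p ^ 2 ≤ 3 * a ^ 2) (hx : x ^ 2 ≤ 2 * p ^ 2) (hS : h ^ 2 ≤ p ^ 2 + x ^ 2)
    (hS3 : p ^ 2 + x ^ 2 ≤ 3 * h ^ 2) :
    (p ^ 2 ≤ h ^ 2 → (2 * p ^ 2 + x ^ 2) / h + 2 * h ≤ 2.406 * x + 4.146 * p - 1.547 * a) ∧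
    (h ^ 2 ≤ p ^ 2 → (p ^ 2 + x ^ 2) / h + 3 * h ≤ 2.406 * x + 4.146 * p - 1.547 * a) := by
  have hp : 0 < p := by linarith
  have hx0 : 0 < x := by linarith
  have hx1 : x ≤ 1.41422 * p := by nlinarith
  have hpx : p ≤ 1.2248 * x := by
    have : p ≤ 1.2248 * a := by nlinarith
    linarith
  obtain ⟨Q, hQ, hQ2⟩ : ∃ Q, 0 < Q ∧ Q ^ 2 = p ^ 2 + x ^ 2 :=
    ⟨√(p ^ 2 + x ^ 2), Real.sqrt_pos.2 (by positivity), Real.sq_sqrt (by positivity)⟩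
  set R := 2.406 * x + 4.146 * p - 1.547 * a with hR
  -- Again `a` is replaced by the smaller of `p` and `x`. Here `1.547 = 1.74 - 0.193`, as an excess
  -- of `0.193 a` is tolerated.
  obtain ⟨R', hR', hRR, hcase⟩ : ∃ R', 0 < R' ∧ R' ≤ R ∧
      ((p ≤ x ∧ R' = 2.406 * x + 2.599 * p) ∨ (x ≤ p ∧ R' = 0.859 * x + 4.146 * p)) := by
    rcases le_total p x with h' | h'
    · exact ⟨_, by positivity, by linarith, Or.inl ⟨h', rfl⟩⟩
    · exact ⟨_, by positivity, by linarith, Or.inr ⟨h', rfl⟩⟩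
  have e1 : 4 * p ^ 2 + x ^ 2 ≤ R' * p := by
    rcases hcase with ⟨h', rfl⟩ | ⟨h', rfl⟩
    · nlinarith [mul_nonneg (sub_nonneg.2 h') (sub_nonneg.2 hx1)]
    · nlinarith
  have e2 : 2 * Q * 1.73206 ≤ R' := by
    refine le_of_sq_le ?_ hR'.le
    have : (2 * Q * 1.73206) ^ 2 = (2 * 1.73206) ^ 2 * (p ^ 2 + x ^ 2) := by rw [← hQ2]; ring
    rw [this]
    rcases hcase with ⟨h', rfl⟩ | ⟨h', rfl⟩
    · nlinarith [mul_nonneg (sub_nonneg.2 h') (sub_nonneg.2 hx1)]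
    · nlinarith [mul_nonneg (sub_nonneg.2 h') (sub_nonneg.2 hpx)]
  have hQl : 0.7071 * (p + x) ≤ Q := by
    refine le_of_sq_le ?_ hQ.le
    rw [hQ2]; nlinarith [sq_nonneg (p - x)]
  have e3 : 4 * p ^ 2 + 3 * x ^ 2 ≤ R' * Q := by
    refine le_trans ?_ (mul_le_mul_of_nonneg_left hQl hR'.le)
    rcases hcase with ⟨h', rfl⟩ | ⟨h', rfl⟩
    · nlinarith [mul_nonneg (sub_nonneg.2 h') (sub_nonneg.2 hx1)]
    · nlinarith [mul_nonneg (sub_nonneg.2 h') (sub_nonneg.2 hpx)]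
  constructor
  · intro h'
    refine (div_add_mul_le_of_endpoints (by norm_num) hp (le_of_sq_le h' hh.le)
      (h₁ := Q) ?_ ?_ ?_).trans hRR
    · exact (le_of_sq_le (by linarith) hQ.le)
    · linarith
    · linarith
  · intro h'
    obtain ⟨t1, t2, t3⟩ := div_sqrt_three_bounds hQ
    refine (div_add_mul_le_of_endpoints (by norm_num) t1
      (le_of_sq_le (by linarith) hh.le) (h₁ := p) ?_ ?_ ?_).trans hRR
    · exact (le_of_sq_le (by linarith) hp.le)
    · rw [t2, ← hQ2]
      have h5 := mul_le_mul_of_nonneg_right e2 t1.le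
      nlinarith
    · linarith

/-- The numerical estimate behind a bad tree and a pair of leaves next to it. -/
lemma bad_pair_real {p x₁ x₂ a h : ℝ} (ha : 0 < a) (hh : 0 < h) (hax : a ≤ x₂)
    (hx : x₂ ≤ x₁) (hxp : x₁ ≤ p) (h23 : 2 * p ^ 2 ≤ 3 * a ^ 2)
    (hS : h ^ 2 ≤ p ^ 2 + (x₁ ^ 2 + x₂ ^ 2)) (hS3 : p ^ 2 + (x₁ ^ 2 + x₂ ^ 2) ≤ 3 * h ^ 2) :
    (x₁ ^ 2 + x₂ ^ 2 ≤ h ^ 2 → (2 * (p ^ 2 + (x₁ ^ 2 + x₂ ^ 2))) / h + 2 * h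
        ≤ 2.406 * (x₁ + x₂) + 4.146 * p - 1.74 * a) ∧
    (h ^ 2 ≤ x₁ ^ 2 + x₂ ^ 2 → (2 * p ^ 2 + (x₁ ^ 2 + x₂ ^ 2)) / h + 3 * h
        ≤ 2.406 * (x₁ + x₂) + 4.146 * p - 1.74 * a) := by
  have hx2 : 0 < x₂ := by linarith
  have hx1 : 0 < x₁ := by linarith
  have hp : 0 < p := by linarith
  have hpx : p ≤ 1.2248 * x₂ := by
    have : p ≤ 1.2248 * a := by nlinarith
    linarith
  obtain ⟨X, hX, hX2⟩ : ∃ X, 0 < X ∧ X ^ 2 = x₁ ^ 2 + x₂ ^ 2 :=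
    ⟨√(x₁ ^ 2 + x₂ ^ 2), Real.sqrt_pos.2 (by positivity), Real.sq_sqrt (by positivity)⟩
  obtain ⟨T, hT, hT2⟩ : ∃ T, 0 < T ∧ T ^ 2 = p ^ 2 + X ^ 2 :=
    ⟨√(p ^ 2 + X ^ 2), Real.sqrt_pos.2 (by positivity), Real.sq_sqrt (by positivity)⟩
  set R := 2.406 * x₁ + 0.666 * x₂ + 4.146 * p with hR
  have hRR : R ≤ 2.406 * (x₁ + x₂) + 4.146 * p - 1.74 * a := by rw [hR]; linarith
  have hR0 : 0 < R := by rw [hR]; positivity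
  -- In the nonnegative variables `x₂`, `d`, `e`, with `d + e` small against `x₂`, the three end
  -- point checks become linear in the monomials.
  obtain ⟨d, hd⟩ : ∃ d, d = x₁ - x₂ := ⟨_, rfl⟩
  obtain ⟨e, he⟩ : ∃ e, e = p - x₁ := ⟨_, rfl⟩
  have hd0 : 0 ≤ d := by linarith
  have he0 : 0 ≤ e := by linarith
  have hde : d + e ≤ 0.2248 * x₂ := by linarith
  have q1 := mul_nonneg hd0 hx2.le
  have q2 := mul_nonneg he0 hx2.le
  have q3 := mul_nonneg hd0 he0
  have q4 := mul_le_mul_of_nonneg_left hde hd0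
  have q5 := mul_le_mul_of_nonneg_left hde he0
  have hx1e : x₁ = x₂ + d := by linarith
  have hpe : p = x₂ + d + e := by linarith
  have hXl : 0.7071 * (x₁ + x₂) ≤ X := by
    refine le_of_sq_le ?_ hX.le
    rw [hX2]; nlinarith [sq_nonneg (x₁ - x₂)]
  have hTl : 0.57735 * (p + x₁ + x₂) ≤ T := by
    refine le_of_sq_le ?_ hT.le
    rw [hT2, hX2]
    nlinarith [sq_nonneg (x₁ - x₂), sq_nonneg (p - x₁), sq_nonneg (p - x₂)]
  have e1 : 4 * T ≤ R := by
    refine le_of_sq_le ?_ hR0.le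
    rw [mul_pow, hT2, hX2, hR, hpe, hx1e]
    linarith [sq_nonneg x₂, sq_nonneg d, sq_nonneg e]
  have e2 : 2 * p ^ 2 + 4 * X ^ 2 ≤ R * X := by
    refine le_trans ?_ (mul_le_mul_of_nonneg_left hXl hR0.le)
    rw [hX2, hR, hpe, hx1e]
    linarith [sq_nonneg x₂, sq_nonneg d, sq_nonneg e]
  have e3 : (2 * T ^ 2 + p ^ 2) * 1.73206 ≤ R * T := by
    refine le_trans ?_ (mul_le_mul_of_nonneg_left hTl hR0.le)
    rw [hT2, hX2, hR, hpe, hx1e]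
    linarith [sq_nonneg x₂, sq_nonneg d, sq_nonneg e]
  rw [← hX2] at hS hS3 ⊢
  rw [← hT2] at hS hS3 ⊢
  constructor
  · intro h'
    refine (div_add_mul_le_of_endpoints (by norm_num) hX (le_of_sq_le h' hh.le)
      (h₁ := T) (le_of_sq_le hS hT.le) ?_ ?_).trans hRR
    · linarith
    · have := mul_le_mul_of_nonneg_right e1 hT.le
      linarith
  · intro h'
    obtain ⟨t1, t2, t3⟩ := div_sqrt_three_bounds hT
    refine (div_add_mul_le_of_endpoints (by norm_num) t1
      (le_of_sq_le (by linarith) hh.le) (h₁ := X)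
      (le_of_sq_le h' hX.le) ?_ ?_).trans hRR
    · rw [t2]
      have h5 := mul_le_mul_of_nonneg_left t3 hR0.le
      linarith
    · linarith

/-! ### Costs compared with the sum of square roots. -/

namespace HTree

/-- The sum of the square roots of the leaf areas. -/
def sig (t : HTree) : ℝ := t.leafSum Real.sqrt

@[simp] lemma sig_leaf (a : ℝ) : (leaf a).sig = √a := rfl

lemma Splits.sig {t k₁ k₂ : HTree} (h : t.Splits k₁ k₂) : t.sig = k₁.sig + k₂.sig :=
  h.leafSum _

/-- The cost of `t` exceeds the bound from the areas by at most that of a rectangle one side of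
which is not charged. -/
def LongBound (t : HTree) : Prop := ∀ h, 0 < h → h ^ 2 ≤ t.wt →
  t.cost h ≤ 2.406 * t.sig + t.wt / h + 0.8 * h - 1.206 * √t.wt

/-- The excess of a bad tree with heavy leaf `a`. -/
def BadBound (b : HTree) (a : ℝ) : Prop := ∀ h, 0 < h → h ^ 2 ≤ 3 * b.wt → b.wt ≤ 3 * h ^ 2 →
  b.cost h ≤ 2.406 * b.sig + b.wt / h + 2 * h - 4.146 * √b.wt + 1.74 * √a ∧
  b.cost h ≤ 2.406 * b.sig + 2 * b.wt / h + h - 4.146 * √b.wt + 1.74 * √a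

/-- The cost of a rectangle of aspect ratio at most three may be computed from its shorter side. -/
lemma cost_le_of_short {t : HTree} (ht : 0 < t.wt) {B : ℝ}
    (H : ∀ h, 0 < h → h ^ 2 ≤ t.wt → t.wt ≤ 3 * h ^ 2 → t.cost h ≤ B) {h : ℝ} (hh : 0 < h)
    (h1 : h ^ 2 ≤ 3 * t.wt) (h2 : t.wt ≤ 3 * h ^ 2) : t.cost h ≤ B := by
  rcases le_total (h ^ 2) t.wt with h3 | h3
  · exact H h hh h3 h2
  · rw [← cost_swap ht hh]
    refine H _ (by positivity) ?_ ?_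
    · rw [div_pow, div_le_iff₀ (by positivity)]; nlinarith
    · rw [div_pow, ← mul_div_assoc, le_div_iff₀ (by positivity)]; nlinarith

/-- Next to the heavy leaf, `s` fills a strip with shorter side `s.wt / h` and longer side `h`.
`LongBound` for this strip and `bad_bound_real` give the estimate. -/
lemma Splits.bad_cost {b s : HTree} {a : ℝ} (hs : b.Splits (leaf a) s) (hb : b.Huff)
    (h2 : 2 * s.wt < a) (hL : s.LongBound) {h : ℝ} (hh : 0 < h) (h3 : h ^ 2 ≤ b.wt)
    (h4 : s.wt ≤ h ^ 2) :
    b.cost h ≤ 2.406 * b.sig + b.wt / h + 2 * h - 4.146 * √b.wt + 1.74 * √a := by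
  have hs0 : 0 < s.wt := (hs.huff hb).2.1.wt_pos
  have ha0 : 0 < a := by linarith
  have hbw : b.wt = a + s.wt := hs.wt
  have e : s.wt / (s.wt / h) = h := by field_simp
  have c1 := hL (s.wt / h) (by positivity) (by
    rw [div_pow, div_le_iff₀ (by positivity)]; nlinarith)
  rw [cost_swap hs0 hh, e] at c1
  rw [hs.cost hh h3, cost_leaf, hs.sig, sig_leaf]
  have r := bad_bound_real (p := √b.wt) (a := √a) (d := √s.wt) (m := h) (Real.sqrt_pos.2 ha0)
    (Real.sqrt_le_sqrt (by linarith))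
    (by rw [Real.sq_sqrt (by linarith), Real.sq_sqrt ha0.le]; linarith) (Real.sqrt_nonneg _)
    (by rw [Real.sq_sqrt hs0.le, Real.sq_sqrt (by linarith), Real.sq_sqrt ha0.le]; linarith)
    hh (Real.le_sqrt_of_sq_le h3)
  rw [Real.sq_sqrt hs0.le, Real.sq_sqrt (hb.wt_pos.le), Real.sq_sqrt ha0.le] at r
  linarith

/-- The cut adds only the shorter side to the perimeter, so the bound holds with either side in its
place. -/
lemma Splits.badBound {b s : HTree} {a : ℝ} (hs : b.Splits (leaf a) s) (hb : b.Huff)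
    (h2 : 2 * s.wt < a) (hL : s.LongBound) : b.BadBound a := by
  intro h hh h3 h4
  have hb0 := hb.wt_pos
  have hbw : b.wt = a + s.wt := hs.wt
  rcases le_total (h ^ 2) b.wt with h5 | h5
  · have c := hs.bad_cost hb h2 hL hh h5 (by linarith)
    have : h ≤ b.wt / h := by rw [le_div_iff₀ hh]; nlinarith
    exact ⟨c, by linarith [mul_div_assoc 2 b.wt h]⟩
  · have c := hs.bad_cost hb h2 hL (h := b.wt / h) (by positivity)
      (by rw [div_pow, div_le_iff₀ (by positivity)]; nlinarith)
      (by rw [div_pow, le_div_iff₀ (by positivity)]; nlinarith)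
    rw [cost_swap hb0 hh] at c
    have e : b.wt / (b.wt / h) = h := by field_simp
    rw [e] at c
    have : b.wt / h ≤ h := by rw [div_le_iff₀ hh]; nlinarith
    exact ⟨by linarith, by linarith [mul_div_assoc 2 b.wt h]⟩

/-- The extreme case is aspect ratio three, with `√3 + 1/√3 < 2.3095`. -/
lemma leaf_cost_le {a h : ℝ} (ha : 0 < a) (hh : 0 < h) (h1 : h ^ 2 ≤ 3 * a) (h2 : a ≤ 3 * h ^ 2) :
    h + a / h ≤ 2.3095 * √a := by
  have hr := Real.sqrt_pos.2 ha
  have hr2 := Real.sq_sqrt ha.le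
  set r := √a
  have h3 : h ≤ 1.73206 * r := by nlinarith
  have h4 : r ≤ 1.73206 * h := by nlinarith
  rw [← hr2, ← sub_nonneg]
  have : 2.3095 * r - (h + r ^ 2 / h) = (2.3095 * r * h - h ^ 2 - r ^ 2) / h := by field_simp; ring
  rw [this]
  apply div_nonneg _ hh.le
  nlinarith [mul_nonneg (sub_nonneg.2 h3) (sub_nonneg.2 h4)]

lemma Pure.kids {t k₁ k₂ : HTree} (ht : t.Pure) (h : t.Splits k₁ k₂) :
    k₁.Pure ∧ k₂.Pure ∧ k₁.wt ≤ 2 * k₂.wt ∧ k₂.wt ≤ 2 * k₁.wt := by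
  rw [Pure, h.pairs] at ht
  have h1 := ht _ (Multiset.mem_cons_self _ _)
  simp only at h1
  refine ⟨fun p hp => ht p (by simp [hp]), fun p hp => ht p (by simp [hp]), ?_, ?_⟩
  · linarith [le_max_left k₁.wt k₂.wt, min_le_right k₁.wt k₂.wt]
  · linarith [le_max_right k₁.wt k₂.wt, min_le_left k₁.wt k₂.wt]

/-- Each part of a cut gets at least a third of the area, so aspect ratio at most three persists
down to the leaves. -/
lemma Pure.cost_le {t : HTree} (ht : t.Pure) (hH : t.Huff) {h : ℝ} (hh : 0 < h)
    (h1 : h ^ 2 ≤ 3 * t.wt) (h2 : t.wt ≤ 3 * h ^ 2) : t.cost h ≤ 2.3095 * t.sig := by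
  induction t generalizing h with
  | leaf a => exact leaf_cost_le hH hh h1 h2
  | node l r hl hr =>
    refine cost_le_of_short hH.wt_pos (fun h hh h1 h2 => ?_) hh h1 h2
    have hs : (node l r).Splits l r := Or.inl rfl
    obtain ⟨p1, p2, p3, p4⟩ := ht.kids hs
    have hl0 := hH.1.wt_pos
    have hr0 := hH.2.1.wt_pos
    rw [hs.wt] at h1 h2
    rw [hs.cost hh (by rw [hs.wt]; exact h1), hs.sig]
    have := hl p1 hH.1 hh (by linarith) (by linarith)
    have := hr p2 hH.2.1 hh (by linarith) (by linarith)
    linarith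

/-- A pure tree beside a semi-bad one saves `2.406 - 2.3095 = 0.0965` times its `sig`. With two
leaves of area at least `a` this covers the excess `0.193 √a`. -/
lemma sig_ge_two {t : HTree} {a : ℝ} (hH : t.Huff) (hl : ∀ z ∈ t.leaves, a ≤ z)
    (ht : ∀ x, t ≠ leaf x) : 2 * √a ≤ t.sig := by
  have one : ∀ s : HTree, s.Huff → (∀ z ∈ s.leaves, a ≤ z) → √a ≤ s.sig := by
    intro s
    induction s with
    | leaf x => intro _ h; exact Real.sqrt_le_sqrt (h x (by simp [leaves]))
    | node l r hl hr =>
      intro hH h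
      have h1 := hl hH.1 fun z hz => h z (by simp [leaves, hz])
      have h2 := hr hH.2.1 fun z hz => h z (by simp [leaves, hz])
      have : (node l r).sig = l.sig + r.sig := rfl
      linarith [Real.sqrt_nonneg a]
  rcases t.exists_splits with ⟨x, rfl⟩ | ⟨k₁, k₂, hs⟩
  · exact absurd rfl (ht x)
  · obtain ⟨h1, h2, -⟩ := hs.huff hH
    rw [hs.sig]
    have := one k₁ h1 fun z hz => hl z (by simp [hs.leaves, hz])
    have := one k₂ h2 fun z hz => hl z (by simp [hs.leaves, hz])
    linarith

section

variable {t q b s y : HTree} {a x : ℝ}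

lemma semi_cost_short (hq : q.Splits b (leaf x)) (hH : q.Huff) (hb : b.Splits (leaf a) s)
    (h2 : 2 * s.wt < a) (hB : b.BadBound a) (hx : x ≤ 2 * b.wt) {h : ℝ} (hh : 0 < h)
    (h3 : h ^ 2 ≤ q.wt) (h4 : q.wt ≤ 3 * h ^ 2) : q.cost h ≤ 2.406 * q.sig + 0.193 * √a := by
  obtain ⟨hbH, hx0, -⟩ := hq.huff hH
  replace hx0 : 0 < x := hx0
  have hs0 := (hb.huff hbH).2.1.wt_pos
  have hax := Semi.bounds hH hq hb h2
  have hbw : b.wt = a + s.wt := hb.wt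
  have hqw : q.wt = b.wt + x := hq.wt
  have ha0 : 0 < a := by linarith
  have hb0 : 0 < b.wt := by linarith
  rw [hq.cost hh h3, cost_leaf, hq.sig, sig_leaf]
  obtain ⟨c1, c2⟩ := hB h hh (by linarith) (by linarith)
  have r := bad_leaf_real (p := √b.wt) (x := √x) (a := √a) (h := h) (Real.sqrt_pos.2 ha0) hh
    (Real.sqrt_le_sqrt (by linarith)) (Real.sqrt_le_sqrt hax)
  rw [Real.sq_sqrt ha0.le, Real.sq_sqrt hb0.le, Real.sq_sqrt hx0.le] at r
  obtain ⟨r1, r2⟩ := r (by linarith) hx (by linarith) (by linarith)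
  rcases le_total b.wt (h ^ 2) with h5 | h5
  · have := r1 h5
    rw [add_div] at this
    linarith
  · have := r2 h5
    rw [add_div] at this
    linarith

lemma semi_cost (hq : q.Splits b (leaf x)) (hH : q.Huff) (hb : b.Splits (leaf a) s)
    (h2 : 2 * s.wt < a) (hB : b.BadBound a) (hx : x ≤ 2 * b.wt) {h : ℝ} (hh : 0 < h)
    (h3 : h ^ 2 ≤ 3 * q.wt) (h4 : q.wt ≤ 3 * h ^ 2) : q.cost h ≤ 2.406 * q.sig + 0.193 * √a :=
  cost_le_of_short hH.wt_pos (fun _ g1 g2 g3 => semi_cost_short hq hH hb h2 hB hx g1 g2 g3) hh h3 h4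

lemma bad_pair_cost {x₁ x₂ : ℝ} (ht : t.Splits b y) (hH : t.Huff) (hb : b.Splits (leaf a) s)
    (h2 : 2 * s.wt < a) (hB : b.BadBound a) (hy : y.Splits (leaf x₁) (leaf x₂))
    (hx : x₂ ≤ x₁) (hax : a ≤ x₂) (hxb : x₁ ≤ b.wt) {h : ℝ} (hh : 0 < h)
    (h3 : h ^ 2 ≤ t.wt) (h4 : t.wt ≤ 3 * h ^ 2) : t.cost h ≤ 2.406 * t.sig := by
  obtain ⟨hbH, hyH, -⟩ := ht.huff hH
  have hs0 := (hb.huff hbH).2.1.wt_pos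
  have hbw : b.wt = a + s.wt := hb.wt
  have htw : t.wt = b.wt + y.wt := ht.wt
  have hyw : y.wt = x₁ + x₂ := hy.wt
  have ha0 : 0 < a := by linarith
  have hb0 : 0 < b.wt := by linarith
  have hy0 : 0 < y.wt := by linarith
  obtain ⟨-, c2⟩ := hB h hh (by linarith) (by linarith)
  have r := bad_pair_real (p := √b.wt) (x₁ := √x₁) (x₂ := √x₂) (a := √a) (h := h)
    (Real.sqrt_pos.2 ha0) hh (Real.sqrt_le_sqrt hax) (Real.sqrt_le_sqrt hx)
    (Real.sqrt_le_sqrt hxb)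
  rw [Real.sq_sqrt ha0.le, Real.sq_sqrt hb0.le, Real.sq_sqrt (by linarith),
    Real.sq_sqrt (by linarith), ← hyw, ← htw] at r
  obtain ⟨r1, r2⟩ := r (by linarith) h3 h4
  rw [ht.cost hh h3, ht.sig, hy.sig, sig_leaf, sig_leaf]
  rcases le_total y.wt (h ^ 2) with h5 | h5
  -- The piece of `y` is now a strip across the rectangle, so the cut between its two leaves has
  -- length `y.wt / h`.
  · have c3 : y.cost h = 2 * y.wt / h + h := by
      rw [← cost_swap hy0 hh, hy.cost (by positivity), cost_leaf, cost_leaf]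
      · rw [hyw]
        have : x₁ + x₂ ≠ 0 := by linarith
        field_simp
        ring
      · rw [div_pow, div_le_iff₀ (by positivity)]; nlinarith
    have r3 := r1 h5
    have e : 2 * t.wt / h = 2 * y.wt / h + 2 * b.wt / h := by rw [htw]; ring
    linarith
  · have c3 : y.cost h = y.wt / h + 2 * h := by
      rw [hy.cost hh h5, cost_leaf, cost_leaf, hyw]; ring
    have r3 := r2 h5
    rw [add_div] at r3
    linarith

lemma bad_leaf_leaf_cost {z : ℝ} (ht : t.Splits q (leaf z)) (hH : t.Huff)
    (hq : q.Splits b (leaf x)) (hb : b.Splits (leaf a) s)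
    (h2 : 2 * s.wt < a) (hB : b.BadBound a) (hx : x ≤ 2 * b.wt) (hz : z ≤ 2 * q.wt) {h : ℝ}
    (hh : 0 < h) (h3 : h ^ 2 ≤ t.wt) (h4 : t.wt ≤ 3 * h ^ 2) : t.cost h ≤ 2.406 * t.sig := by
  obtain ⟨hqH, hz0, -⟩ := ht.huff hH
  obtain ⟨hbH, hx0, -⟩ := hq.huff hqH
  replace hz0 : 0 < z := hz0
  replace hx0 : 0 < x := hx0
  have hs0 := (hb.huff hbH).2.1.wt_pos
  have hbw : b.wt = a + s.wt := hb.wt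
  have htw : t.wt = q.wt + z := ht.wt
  have hqw : q.wt = b.wt + x := hq.wt
  have ha0 : 0 < a := by linarith
  have hb0 : 0 < b.wt := by linarith
  have hq0 : 0 < q.wt := by linarith
  have hax := Semi.bounds hqH hq hb h2
  have hmz := (sibling_of_semi hH ht hq hb h2).1
  rw [wt_leaf, max_le_iff] at hmz
  have r := bad_leaf_leaf_real (p := √b.wt) (x := √x) (y := √z) (a := √a) (h := h)
    (Real.sqrt_pos.2 ha0) hh (Real.sqrt_le_sqrt (by linarith)) (Real.sqrt_le_sqrt hax)
    (Real.sqrt_le_sqrt hmz.1) (Real.sqrt_le_sqrt hmz.2)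
  rw [Real.sq_sqrt ha0.le, Real.sq_sqrt hb0.le, Real.sq_sqrt hx0.le, Real.sq_sqrt hz0.le,
    ← hqw, ← htw] at r
  obtain ⟨r1, r2⟩ := r (by linarith) hx hz h3 h4
  rw [ht.cost hh h3, ht.sig, hq.sig, sig_leaf, sig_leaf, cost_leaf]
  rcases le_total q.wt (h ^ 2) with h5 | h5
  · have r3 := r1 h5
    have hk0 : 0 < q.wt / h := by positivity
    have hk : (q.wt / h) ^ 2 ≤ q.wt := by
      rw [div_pow, div_le_iff₀ (by positivity)]; nlinarith
    have hk3 : q.wt ≤ 3 * (q.wt / h) ^ 2 := by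
      rw [div_pow, ← mul_div_assoc, le_div_iff₀ (by positivity)]; nlinarith
    obtain ⟨-, c2⟩ := hB (q.wt / h) hk0 (by linarith) (by linarith)
    rw [← cost_swap hq0 hh, hq.cost hk0 hk, cost_leaf]
    have e1 : (2 * q.wt + z) / h + (2 + b.wt / q.wt) * h =
        2 * b.wt / (q.wt / h) + q.wt / h + (q.wt / h + x / (q.wt / h)) + (h + z / h) := by
      rw [hqw]
      have : b.wt + x ≠ 0 := by linarith
      field_simp
      ring
    linarith
  · have r3 := r2 h5
    obtain ⟨-, c2⟩ := hB h hh (by linarith) (by linarith)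
    rw [hq.cost hh h5, cost_leaf]
    rw [add_div, add_div] at r3
    linarith

end

/-- A tree which is neither bad nor semi-bad is within the factor `1.203` of the bound from the
areas, on rectangles of aspect ratio at most three. -/
def GoodBound (t : HTree) : Prop := ¬ t.Bad → ¬ t.Semi → ∀ h, 0 < h → h ^ 2 ≤ t.wt →
  t.wt ≤ 3 * h ^ 2 → t.cost h ≤ 2.406 * t.sig

/-- If no child is bad or semi-bad, the children inherit aspect ratio at most three and induction
applies. A bad child has a pair of leaves as sibling, since a leaf would make `t` semi-bad. The
sibling of a semi-bad child is a leaf or a pure tree with at least two large leaves. -/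
lemma goodBound_of_smaller {t : HTree} (hH : t.Huff)
    (IH : ∀ s : HTree, s.size < t.size → s.Huff → s.LongBound ∧ s.GoodBound) : t.GoodBound := by
  intro hb hse h hh h3 h4
  rcases t.exists_splits with ⟨x, rfl⟩ | ⟨k₁, k₂, hs⟩
  · have hx : 0 < x := hH
    rw [wt_leaf] at h3 h4
    have := leaf_cost_le hx hh (by linarith) h4
    rw [cost_leaf, sig_leaf]
    linarith [Real.sqrt_nonneg x]
  have keybad : ∀ k₁ k₂, t.Splits k₁ k₂ → k₁.Bad → t.cost h ≤ 2.406 * t.sig := by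
    rintro k₁ k₂ hs ⟨a, s, hk, h2⟩
    obtain ⟨hkH, hk2H, -⟩ := hs.huff hH
    have hB := hk.badBound hkH h2
      (IH s (hk.symm.size_lt.trans hs.size_lt) (hk.huff hkH).2.1).1
    by_cases hleaf : ∃ x, k₂ = leaf x
    · obtain ⟨x, rfl⟩ := hleaf
      exact absurd ⟨k₁, x, hs, ⟨a, s, hk, h2⟩, hs.symm.le_two_mul hH hb⟩ hse
    · push Not at hleaf
      obtain ⟨x₁, x₂, hy, g1, g2, g3⟩ := sibling_of_bad hH hs hk h2 hleaf
      exact bad_pair_cost hs hH hk h2 hB hy g1 g2 g3 hh h3 h4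
  by_cases hb1 : k₁.Bad
  · exact keybad _ _ hs hb1
  by_cases hb2 : k₂.Bad
  · exact keybad _ _ hs.symm hb2
  have keysemi : ∀ k₁ k₂, t.Splits k₁ k₂ → k₁.Semi → t.cost h ≤ 2.406 * t.sig := by
    rintro k₁ k₂ hs ⟨b, x, hq, ⟨a, s, hk, h2⟩, hx⟩
    obtain ⟨hqH, hk2H, -⟩ := hs.huff hH
    have hbH := (hq.huff hqH).1
    have hB := hk.badBound hbH h2
      (IH s (hk.symm.size_lt.trans (hq.size_lt.trans hs.size_lt)) (hk.huff hbH).2.1).1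
    have b1 := hs.le_two_mul hH hb
    have b2 := hs.symm.le_two_mul hH hb
    by_cases hleaf : ∃ z, k₂ = leaf z
    · obtain ⟨z, rfl⟩ := hleaf
      exact bad_leaf_leaf_cost hs hH hq hk h2 hB hx b2 hh h3 h4
    · push Not at hleaf
      obtain ⟨-, hP, hl⟩ := sibling_of_semi hH hs hq hk h2
      have hw := hs.wt
      have := hqH.wt_pos
      have := hk2H.wt_pos
      have c1 := semi_cost hq hqH hk h2 hB hx hh (by linarith) (by linarith)
      have c2 := hP.cost_le hk2H hh (by linarith) (by linarith)
      have c3 := sig_ge_two hk2H hl hleaf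
      rw [hs.cost hh h3, hs.sig]
      linarith
  by_cases hs1 : k₁.Semi
  · exact keysemi _ _ hs hs1
  by_cases hs2 : k₂.Semi
  · exact keysemi _ _ hs.symm hs2
  obtain ⟨h1H, h2H, -⟩ := hs.huff hH
  have b1 := hs.le_two_mul hH hb
  have b2 := hs.symm.le_two_mul hH hb
  have hw := hs.wt
  have := h1H.wt_pos
  have := h2H.wt_pos
  have c1 := cost_le_of_short h1H.wt_pos ((IH k₁ hs.size_lt h1H).2 hb1 hs1) hh (by linarith)
    (by linarith)
  have c2 := cost_le_of_short h2H.wt_pos ((IH k₂ hs.symm.size_lt h2H).2 hb2 hs2) hh (by linarith)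
    (by linarith)
  rw [hs.cost hh h3, hs.sig]
  linarith

lemma sqrt_add_le {k₁ k₂ : ℝ} (h1 : 0 ≤ k₁) (h2 : 0 ≤ k₂) : √(k₁ + k₂) ≤ √k₁ + √k₂ := by
  refine Real.sqrt_le_iff.2 ⟨by positivity, ?_⟩
  nlinarith [Real.sq_sqrt h1, Real.sq_sqrt h2, Real.sqrt_nonneg k₁, Real.sqrt_nonneg k₂,
    mul_nonneg (Real.sqrt_nonneg k₁) (Real.sqrt_nonneg k₂)]

/-- By concavity the extreme ratio is `1 : 2`, where the quotient is `(1 + √2)/√3 > 1.39`. -/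
lemma sqrt_add_sqrt_ge {k₁ k₂ : ℝ} (h1 : 0 < k₁) (h2 : 0 < k₂) (h12 : k₁ ≤ 2 * k₂)
    (h21 : k₂ ≤ 2 * k₁) : 1.39 * √(k₁ + k₂) ≤ √k₁ + √k₂ := by
  have r1 := Real.sqrt_pos.2 h1
  have r2 := Real.sqrt_pos.2 h2
  have e1 := Real.sq_sqrt h1.le
  have e2 := Real.sq_sqrt h2.le
  set u := √k₁
  set v := √k₂
  refine le_of_sq_le ?_ (by positivity)
  rw [mul_pow, Real.sq_sqrt (by linarith), ← e1, ← e2]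
  have h3 : u ≤ 1.41422 * v := by nlinarith
  have h4 : v ≤ 1.41422 * u := by nlinarith
  nlinarith [mul_nonneg (sub_nonneg.2 h3) (sub_nonneg.2 h4)]

lemma longBound_of_smaller {t : HTree} (hH : t.Huff)
    (IH : ∀ s : HTree, s.size < t.size → s.Huff → s.LongBound ∧ s.GoodBound) : t.LongBound := by
  intro h hh h3
  have ht0 := hH.wt_pos
  have hp : h ≤ √t.wt := Real.le_sqrt_of_sq_le h3
  have hp2 := Real.sq_sqrt ht0.le
  have hp0 := Real.sqrt_pos.2 ht0
  by_cases hb : t.Bad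
  · obtain ⟨a, s, hs, h2⟩ := hb
    have hsH := (hs.huff hH).2.1
    have hs0 := hsH.wt_pos
    have hL := (IH s hs.symm.size_lt hsH).1
    have hw : t.wt = a + s.wt := hs.wt
    have hap : √a ≤ √t.wt := Real.sqrt_le_sqrt (by linarith)
    rcases le_total s.wt (h ^ 2) with h4 | h4
    · have := hs.bad_cost hH h2 hL hh h3 h4
      linarith
    -- The piece of `s` still has shorter side `h`. The new side `h` is paid for by the heavy leaf,
    -- as `h ≤ √s.wt ≤ √a`.
    · have c := hL h hh h4
      rw [hs.cost hh h3, cost_leaf, hs.sig, sig_leaf]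
      have e : t.wt / h = a / h + s.wt / h := by rw [hw, add_div]
      have e2 : √t.wt ≤ √a + √s.wt := by rw [hw]; exact sqrt_add_le (by linarith) hs0.le
      have e3 : h ≤ √s.wt := Real.le_sqrt_of_sq_le h4
      have e4 : √s.wt ≤ √a := Real.sqrt_le_sqrt (by linarith)
      linarith
  · rcases t.exists_splits with ⟨x, rfl⟩ | ⟨k₁, k₂, hs⟩
    · rw [cost_leaf, sig_leaf, wt_leaf] at *
      linarith
    obtain ⟨h1H, h2H, -⟩ := hs.huff hH
    have h10 := h1H.wt_pos
    have h20 := h2H.wt_pos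
    have b1 := hs.le_two_mul hH hb
    have b2 := hs.symm.le_two_mul hH hb
    have hw := hs.wt
    rcases le_total t.wt (3 * h ^ 2) with h4 | h4
    · have e : 0.193 * √t.wt ≤ t.wt / h + 0.8 * h - 1.206 * √t.wt := by
        nth_rw 2 [← hp2]
        set p := √t.wt
        have : p ^ 2 / h + 0.8 * h - 1.206 * p - 0.193 * p
            = (p ^ 2 + 0.8 * h ^ 2 - 1.399 * p * h) / h := by field_simp; ring
        rw [← sub_nonneg, this]
        apply div_nonneg _ hh.le
        nlinarith [sq_nonneg (p - 0.7 * h)]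
      by_cases hse : t.Semi
      · obtain ⟨b, x, hq, ⟨a, s, hk, h2⟩, hx⟩ := hse
        have hbH := (hq.huff hH).1
        have hL := (IH s (hk.symm.size_lt.trans hq.size_lt) (hk.huff hbH).2.1).1
        have c := semi_cost_short hq hH hk h2 (hk.badBound hbH h2 hL) hx hh h3 h4
        have hbw : b.wt = a + s.wt := hk.wt
        have htw : t.wt = b.wt + x := hq.wt
        have := (hk.huff hbH).2.1.wt_pos
        have hx0 : 0 < x := (hq.huff hH).2.1
        have hap : √a ≤ √t.wt := Real.sqrt_le_sqrt (by linarith)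
        linarith
      · have c := goodBound_of_smaller hH IH hb hse h hh h3 h4
        linarith
    -- Both pieces keep the shorter side `h`. The second `0.8 h` is covered by `1.206 (√k₁ + √k₂ -
    -- √t)`, at least `1.206 * 0.39 * 1.732 h`.
    · have c1 := (IH k₁ hs.size_lt h1H).1 h hh (by linarith)
      have c2 := (IH k₂ hs.symm.size_lt h2H).1 h hh (by linarith)
      have e1 := sqrt_add_sqrt_ge h10 h20 b1 b2
      rw [← hw] at e1
      have e2 : 1.732 * h ≤ √t.wt := Real.le_sqrt_of_sq_le (by nlinarith)
      have e3 : t.wt / h = k₁.wt / h + k₂.wt / h := by rw [hw, add_div]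
      rw [hs.cost hh h3, hs.sig]
      linarith

theorem Huff.bounds {t : HTree} (hH : t.Huff) : t.LongBound ∧ t.GoodBound := by
  induction hn : t.size using Nat.strong_induction_on generalizing t with
  | _ n ih =>
    subst hn
    have IH : ∀ s : HTree, s.size < t.size → s.Huff → s.LongBound ∧ s.GoodBound :=
      fun s hs hsH => ih s.size hs hsH rfl
    exact ⟨longBound_of_smaller hH IH, goodBound_of_smaller hH IH⟩

end HTree

/-! ### Thin rectangles and the lower bound from a short side. -/

/-- A lower bound for the perimeter of a rectangle of area `a` one side of which is at most `v`. -/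
def minPerim (v a : ℝ) : ℝ := if a ≤ v ^ 2 then 2 * √a else v + a / v

lemma minPerim_eq {v a : ℝ} (hv : 0 < v) (h : v ^ 2 ≤ a) : minPerim v a = v + a / v := by
  unfold minPerim
  split_ifs with h1
  · have : a = v ^ 2 := le_antisymm h1 h
    rw [this, Real.sqrt_sq hv.le]
    field_simp; ring
  · rfl

lemma two_sqrt_le_add_div {v a : ℝ} (hv : 0 < v) (ha : 0 ≤ a) : 2 * √a ≤ v + a / v := by
  have : v + a / v - 2 * √a = (v - √a) ^ 2 / v := by
    rw [sub_sq, Real.sq_sqrt ha]; field_simp; ring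
  have h2 : 0 ≤ (v - √a) ^ 2 / v := by positivity
  linarith

lemma two_sqrt_le_minPerim {v a : ℝ} (hv : 0 < v) (ha : 0 ≤ a) : 2 * √a ≤ minPerim v a := by
  unfold minPerim
  split_ifs
  · rfl
  · exact two_sqrt_le_add_div hv ha

/-- The function `x + a / x` has its minimum at `√a` and decreases before it. -/
lemma minPerim_le {v a x y : ℝ} (hx : 0 < x) (hy : 0 < y) (ha : x * y = a) (hxv : x ≤ v) :
    minPerim v a ≤ x + y := by
  have hv : 0 < v := hx.trans_le hxv
  have hyx : y = a / x := by rw [← ha]; field_simp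
  unfold minPerim
  split_ifs with h
  · rw [hyx]; exact two_sqrt_le_add_div hx (by rw [← ha]; positivity)
  · push Not at h
    rw [← sub_nonneg]
    have : x + y - (v + a / v) = (v - x) * (y - v) / v := by
      rw [← ha]; field_simp; ring
    rw [this]
    have : v ≤ y := by
      by_contra! h2
      nlinarith
    exact div_nonneg (mul_nonneg (sub_nonneg.2 hxv) (sub_nonneg.2 this)) hv.le

namespace HTree

/-- The sum of the lower bounds `minPerim v` over the leaves. -/
def lb (t : HTree) (v : ℝ) : ℝ := t.leafSum (minPerim v)

@[simp] lemma lb_leaf (a v : ℝ) : (leaf a).lb v = minPerim v a := rfl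

lemma Splits.lb {t k₁ k₂ : HTree} (h : t.Splits k₁ k₂) (v : ℝ) :
    t.lb v = k₁.lb v + k₂.lb v := h.leafSum _

lemma Huff.two_sig_le_lb {t : HTree} (hH : t.Huff) {v : ℝ} (hv : 0 < v) :
    2 * t.sig ≤ t.lb v := by
  induction t with
  | leaf a => exact two_sqrt_le_minPerim hv (le_of_lt hH)
  | node l r hl hr =>
    have h1 := hl hH.1
    have h2 := hr hH.2.1
    have h3 : (node l r).sig = l.sig + r.sig := rfl
    have h4 : (node l r).lb v = l.lb v + r.lb v := rfl
    linarith

lemma Pure.cost_le_lb {t : HTree} (ht : t.Pure) (hH : t.Huff) {h : ℝ} (hh : 0 < h)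
    (h1 : h ^ 2 ≤ t.wt) : t.cost h ≤ 1.203 * t.lb h - 0.0965 * t.sig := by
  induction t with
  | leaf a =>
    rw [wt_leaf] at h1
    rw [cost_leaf, lb_leaf, sig_leaf, minPerim_eq hh h1]
    have := two_sqrt_le_add_div hh (le_of_lt hH : (0 : ℝ) ≤ a)
    linarith [Real.sqrt_nonneg a]
  | node l r hl hr =>
    rcases le_total (node l r).wt (3 * h ^ 2) with h2 | h2
    · have c := ht.cost_le hH hh (by linarith [sq_nonneg h]) h2
      have := hH.two_sig_le_lb hh
      linarith
    · have hs : (node l r).Splits l r := Or.inl rfl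
      obtain ⟨p1, p2, p3, p4⟩ := ht.kids hs
      have hw := hs.wt
      have c1 := hl p1 hH.1 (by linarith)
      have c2 := hr p2 hH.2.1 (by linarith)
      rw [hs.cost hh h1, hs.sig, hs.lb]
      linarith

/-- On rectangles of aspect ratio at most three at most one shorter side is not charged. -/
lemma Huff.fat {t : HTree} (hH : t.Huff) {h : ℝ} (hh : 0 < h) (h1 : h ^ 2 ≤ t.wt)
    (h2 : t.wt ≤ 3 * h ^ 2) : t.cost h ≤ 2.406 * t.sig + t.wt / h + 2 * h - 2.406 * √t.wt := by
  have ht0 := hH.wt_pos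
  have hp2 := Real.sq_sqrt ht0.le
  have hp0 := Real.sqrt_pos.2 ht0
  by_cases hb : t.Bad
  · obtain ⟨a, s, hs, h3⟩ := hb
    have hsH := (hs.huff hH).2.1
    have := (hs.badBound hH h3 hsH.bounds.1 h hh (by linarith) h2).1
    have hw : t.wt = a + s.wt := hs.wt
    have hap : √a ≤ √t.wt := Real.sqrt_le_sqrt (by linarith [hsH.wt_pos])
    linarith
  have e : 0.193 * √t.wt ≤ t.wt / h + 2 * h - 2.406 * √t.wt := by
    nth_rw 2 [← hp2]
    set p := √t.wt
    have : p ^ 2 / h + 2 * h - 2.406 * p - 0.193 * p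
        = (p ^ 2 + 2 * h ^ 2 - 2.599 * p * h) / h := by field_simp; ring
    rw [← sub_nonneg, this]
    apply div_nonneg _ hh.le
    nlinarith [sq_nonneg (p - 1.3 * h)]
  by_cases hse : t.Semi
  · obtain ⟨b, x, hq, ⟨a, s, hk, h3⟩, hx⟩ := hse
    have hbH := (hq.huff hH).1
    have hsH := (hk.huff hbH).2.1
    have c := semi_cost_short hq hH hk h3 (hk.badBound hbH h3 hsH.bounds.1) hx hh h1 h2
    have hbw : b.wt = a + s.wt := hk.wt
    have htw : t.wt = b.wt + x := hq.wt
    have hx0 : 0 < x := (hq.huff hH).2.1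
    have hap : √a ≤ √t.wt := Real.sqrt_le_sqrt (by linarith [hsH.wt_pos])
    linarith
  · have c := hH.bounds.2 hb hse h hh h1 h2
    linarith

/-- The bounds on thin rectangles with shorter side `h`. -/
def ThinBound (t : HTree) : Prop := ∀ h, 0 < h → 3 * h ^ 2 ≤ t.wt →
  (¬ t.Bad → t.cost h ≤ 1.203 * t.lb h) ∧ t.cost h ≤ 1.203 * t.lb h + 0.4 * h

/-- The cost of a strip next to a heavy leaf. -/
lemma Huff.strip {s : HTree} (hH : s.Huff) {h : ℝ} (hh : 0 < h) (h1 : s.wt ≤ h ^ 2) :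
    s.cost h ≤ 2.406 * s.sig + h - 0.406 * (s.wt / h) := by
  have hs0 := hH.wt_pos
  have e : s.wt / (s.wt / h) = h := by field_simp
  have h2 : (s.wt / h) ^ 2 ≤ s.wt := by
    rw [div_pow, div_le_iff₀ (by positivity)]; nlinarith
  have c := hH.bounds.1 (s.wt / h) (by positivity) h2
  rw [cost_swap hs0 hh, e] at c
  have := Real.le_sqrt_of_sq_le h2
  linarith

/-- The heavy leaf has long side at least `2h` and pays through `0.203` times its perimeter. The
error `0.4 h` is needed only when the strip `s` is narrower than `h`. -/
lemma bad_thin {t s : HTree} {a : ℝ} (hs : t.Splits (leaf a) s) (hH : t.Huff)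
    (h2 : 2 * s.wt < a) (IH : s.ThinBound) {h : ℝ} (hh : 0 < h) (h3 : 3 * h ^ 2 ≤ t.wt) :
    t.cost h ≤ 1.203 * t.lb h + 0.4 * h ∧ (h ^ 2 ≤ s.wt → t.cost h ≤ 1.203 * t.lb h) := by
  have hsH := (hs.huff hH).2.1
  have hs0 := hsH.wt_pos
  have hw : t.wt = a + s.wt := hs.wt
  have hh2 : 0 < h ^ 2 := by positivity
  have ha : 2 * h ≤ a / h := by rw [le_div_iff₀ hh]; nlinarith
  have hlb := hsH.two_sig_le_lb hh
  rw [hs.cost hh (by linarith), hs.lb, lb_leaf, cost_leaf, minPerim_eq hh (by linarith)]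
  have big : h ^ 2 ≤ s.wt → h + a / h + s.cost h ≤ 1.203 * (h + a / h + s.lb h) := by
    intro h4
    rcases le_total s.wt (3 * h ^ 2) with h5 | h5
    · have c := hsH.fat hh h4 h5
      have hz : 2 * (s.wt / h) ≤ a / h := by rw [← mul_div_assoc]; gcongr
      have hr2 := Real.sq_sqrt hs0.le
      have hr0 : h ≤ √s.wt := Real.le_sqrt_of_sq_le h4
      have hr1 : √s.wt ≤ 1.73206 * h := by
        refine Real.sqrt_le_iff.2 ⟨by linarith, ?_⟩
        nlinarith
      have : 0.594 * (s.wt / h) + 1.797 * h ≤ 2.406 * √s.wt := by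
        nth_rw 1 [← hr2]
        set r := √s.wt
        have e : 2.406 * r - (0.594 * (r ^ 2 / h) + 1.797 * h)
            = (2.406 * r * h - 0.594 * r ^ 2 - 1.797 * h ^ 2) / h := by field_simp; ring
        rw [← sub_nonneg, e]
        apply div_nonneg _ hh.le
        nlinarith [mul_nonneg (sub_nonneg.2 hr0) (sub_nonneg.2 hr1)]
      linarith
    · have c := (IH h hh h5).2
      linarith
  refine ⟨?_, big⟩
  rcases le_total s.wt (h ^ 2) with h4 | h4
  · have c := hsH.strip hh h4
    have : 0 ≤ s.wt / h := by positivity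
    linarith
  · linarith [big h4]

/-- For a bad child of a thin tree. The term `0.203 (b.wt / h)` is kept so that it can be added to
the saving of the sibling. -/
lemma bad_medium {b s : HTree} {a : ℝ} (hs : b.Splits (leaf a) s) (hH : b.Huff)
    (h2 : 2 * s.wt < a) {h : ℝ} (hh : 0 < h) (h3 : h ^ 2 ≤ b.wt) (h4 : b.wt ≤ 3 * h ^ 2) :
    b.cost h + 0.203 * (b.wt / h) ≤ 1.203 * b.lb h + 0.8 * h := by
  have hsH := (hs.huff hH).2.1
  have hs0 := hsH.wt_pos
  have hw : b.wt = a + s.wt := hs.wt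
  have ha0 : 0 < a := by linarith
  have hlb := hsH.two_sig_le_lb hh
  have c := hsH.strip hh (by linarith)
  have e : b.wt / h = a / h + s.wt / h := by rw [hw, add_div]
  have hz : 0 ≤ s.wt / h := by positivity
  rw [hs.cost hh h3, hs.lb, lb_leaf, cost_leaf, e]
  rcases le_total (h ^ 2) a with h5 | h5
  · rw [minPerim_eq hh h5]
    linarith
  · rw [minPerim, if_pos h5]
    have hr2 := Real.sq_sqrt ha0.le
    have hr1 : √a ≤ h := Real.sqrt_le_iff.2 ⟨hh.le, h5⟩
    have hr0 : 0.8164 * h ≤ √a := Real.le_sqrt_of_sq_le (by nlinarith)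
    have hz1 : h - a / h ≤ s.wt / h := by
      rw [sub_le_iff_le_add, ← add_div, le_div_iff₀ hh]; nlinarith
    have : 1.406 * (a / h) + 0.997 * h ≤ 2.406 * √a := by
      nth_rw 1 [← hr2]
      set r := √a
      have e : 2.406 * r - (1.406 * (r ^ 2 / h) + 0.997 * h)
          = (2.406 * r * h - 1.406 * r ^ 2 - 0.997 * h ^ 2) / h := by field_simp; ring
      rw [← sub_nonneg, e]
      apply div_nonneg _ hh.le
      nlinarith [mul_nonneg (sub_nonneg.2 hr0) (sub_nonneg.2 hr1)]
    linarith

/-- For the pair of leaves beside a bad tree `b`: `b` and the larger leaf are at most `3/2` of the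
smaller one, so a total of `3 h ^ 2` leaves it at least `3/4 h ^ 2`. -/
lemma leaf_slack {x h : ℝ} (hx : 0 < x) (hh : 0 < h) (h1 : 3 * h ^ 2 ≤ 4 * x) :
    h + x / h + 0.3 * h ≤ 1.203 * minPerim h x := by
  rcases le_total (h ^ 2) x with h5 | h5
  · rw [minPerim_eq hh h5]
    have : h ≤ x / h := by rw [le_div_iff₀ hh]; nlinarith
    linarith
  · rw [minPerim, if_pos h5]
    have hr2 := Real.sq_sqrt hx.le
    have hr1 : √x ≤ h := Real.sqrt_le_iff.2 ⟨hh.le, h5⟩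
    have hr0 : 0.866 * h ≤ √x := Real.le_sqrt_of_sq_le (by nlinarith)
    nth_rw 1 [← hr2]
    set r := √x
    have e : 1.203 * (2 * r) - (h + r ^ 2 / h + 0.3 * h)
        = (2.406 * r * h - r ^ 2 - 1.3 * h ^ 2) / h := by field_simp; ring
    rw [← sub_nonneg, e]
    apply div_nonneg _ hh.le
    nlinarith [mul_nonneg (sub_nonneg.2 hr0) (sub_nonneg.2 hr1)]

lemma thin_of_smaller {t : HTree} (hH : t.Huff)
    (IH : ∀ s : HTree, s.size < t.size → s.Huff → s.ThinBound) : t.ThinBound := by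
  intro h hh h3
  have hh2 : 0 < h ^ 2 := by positivity
  by_cases hb : t.Bad
  · obtain ⟨a, s, hs, h2⟩ := hb
    exact ⟨fun h' => absurd ⟨a, s, hs, h2⟩ h',
      (bad_thin hs hH h2 (IH s hs.symm.size_lt (hs.huff hH).2.1) hh h3).1⟩
  suffices hc : t.cost h ≤ 1.203 * t.lb h from ⟨fun _ => hc, by linarith⟩
  rcases t.exists_splits with ⟨x, rfl⟩ | ⟨k₁, k₂, hs⟩
  · rw [wt_leaf] at h3
    rw [cost_leaf, lb_leaf, minPerim_eq hh (by linarith)]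
    have : 0 ≤ x / h := div_nonneg (by linarith) hh.le
    linarith
  have hw' : ∀ k₁ k₂, t.Splits k₁ k₂ → h ^ 2 ≤ k₁.wt ∧ h ^ 2 ≤ k₂.wt := by
    intro k₁ k₂ hs
    have b1 := hs.le_two_mul hH hb
    have b2 := hs.symm.le_two_mul hH hb
    have hw := hs.wt
    exact ⟨by linarith, by linarith⟩
  have keybad : ∀ k₁ k₂, t.Splits k₁ k₂ → k₁.Bad → t.cost h ≤ 1.203 * t.lb h := by
    rintro b y hs ⟨a, s, hk, h2⟩
    obtain ⟨hbH, hyH, -⟩ := hs.huff hH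
    have hsH := (hk.huff hbH).2.1
    obtain ⟨g1, g2⟩ := hw' _ _ hs
    have hw := hs.wt
    have hbw : b.wt = a + s.wt := hk.wt
    have hthin := fun h' => (bad_thin hk hbH h2
      (IH s (hk.symm.size_lt.trans hs.size_lt) hsH) hh h').1
    have hmed := bad_medium hk hbH h2 hh g1
    rw [hs.cost hh (by linarith), hs.lb]
    have hbh : h ≤ b.wt / h := by rw [le_div_iff₀ hh]; nlinarith
    by_cases hleaf : ∃ x, y = leaf x
    · obtain ⟨x, rfl⟩ := hleaf
      have b1 : b.wt ≤ 2 * x := hs.le_two_mul hH hb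
      rw [wt_leaf] at g2 hw
      rw [cost_leaf, lb_leaf, minPerim_eq hh g2]
      rcases le_total b.wt (3 * h ^ 2) with h4 | h4
      · have c := hmed h4
        have : 3 * h ≤ b.wt / h + x / h := by
          rw [← add_div, ← hw, le_div_iff₀ hh]; linarith
        linarith
      · have c := hthin h4
        have : 1.5 * h ≤ x / h := by rw [le_div_iff₀ hh]; nlinarith
        linarith
    · push Not at hleaf
      obtain ⟨x₁, x₂, hy, e1, e2, e3⟩ := sibling_of_bad hH hs hk h2 hleaf
      have hyw : y.wt = x₁ + x₂ := hy.wt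
      have hs0 := hsH.wt_pos
      rw [hy.cost hh g2, hy.lb, cost_leaf, cost_leaf, lb_leaf, lb_leaf]
      have l1 := leaf_slack (x := x₁) (by linarith) hh (by linarith)
      have l2 := leaf_slack (x := x₂) (by linarith) hh (by linarith)
      rcases le_total b.wt (3 * h ^ 2) with h4 | h4
      · linarith [hmed h4]
      · linarith [hthin h4]
  by_cases hb1 : k₁.Bad
  · exact keybad _ _ hs hb1
  by_cases hb2 : k₂.Bad
  · exact keybad _ _ hs.symm hb2
  have keysemi : ∀ k₁ k₂, t.Splits k₁ k₂ → k₁.Semi → k₁.wt ≤ 3 * h ^ 2 →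
      t.cost h ≤ 1.203 * t.lb h := by
    rintro q y hs ⟨b, x, hq, ⟨a, s, hk, h2⟩, hx⟩ h4
    obtain ⟨hqH, hyH, -⟩ := hs.huff hH
    have hbH := (hq.huff hqH).1
    have hsH := (hk.huff hbH).2.1
    have hs0 := hsH.wt_pos
    obtain ⟨g1, g2⟩ := hw' _ _ hs
    have hbw : b.wt = a + s.wt := hk.wt
    have hqw : q.wt = b.wt + x := hq.wt
    have hax := Semi.bounds hqH hq hk h2
    have c1 := semi_cost_short hq hqH hk h2 (hk.badBound hbH h2 hsH.bounds.1) hx hh g1 h4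
    have hlb := hqH.two_sig_le_lb hh
    rw [hs.cost hh (by linarith), hs.lb]
    by_cases hleaf : ∃ z, y = leaf z
    · obtain ⟨z, rfl⟩ := hleaf
      rw [wt_leaf] at g2
      rw [cost_leaf, lb_leaf, minPerim_eq hh g2]
      have e1 : √a ≤ 1.2248 * h := Real.sqrt_le_iff.2 ⟨by positivity, by nlinarith⟩
      have e2 : h ≤ z / h := by rw [le_div_iff₀ hh]; nlinarith
      linarith
    · push Not at hleaf
      obtain ⟨-, hP, hl⟩ := sibling_of_semi hH hs hq hk h2
      have c2 := hP.cost_le_lb hyH hh g2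
      have c3 := sig_ge_two hyH hl hleaf
      linarith
  -- A semi-bad child matters only at aspect ratio at most three; a thinner one is covered by
  -- induction.
  have kid : ∀ k : HTree, k.size < t.size → k.Huff → h ^ 2 ≤ k.wt → ¬ k.Bad →
      ¬ (k.Semi ∧ k.wt ≤ 3 * h ^ 2) → k.cost h ≤ 1.203 * k.lb h := by
    intro k hk hkH g hkb hks
    rcases le_total k.wt (3 * h ^ 2) with h4 | h4
    · have c := hkH.bounds.2 hkb (fun h' => hks ⟨h', h4⟩) h hh g h4
      have := hkH.two_sig_le_lb hh
      linarith
    · exact (IH k hk hkH h hh h4).1 hkb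
  by_cases hs1 : k₁.Semi ∧ k₁.wt ≤ 3 * h ^ 2
  · exact keysemi _ _ hs hs1.1 hs1.2
  by_cases hs2 : k₂.Semi ∧ k₂.wt ≤ 3 * h ^ 2
  · exact keysemi _ _ hs.symm hs2.1 hs2.2
  obtain ⟨h1H, h2H, -⟩ := hs.huff hH
  obtain ⟨g1, g2⟩ := hw' _ _ hs
  have c1 := kid k₁ hs.size_lt h1H g1 hb1 hs1
  have c2 := kid k₂ hs.symm.size_lt h2H g2 hb2 hs2
  rw [hs.cost hh (by linarith), hs.lb]
  linarith

theorem Huff.thinBound {t : HTree} (hH : t.Huff) : t.ThinBound := by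
  induction hn : t.size using Nat.strong_induction_on generalizing t with
  | _ n ih =>
    subst hn
    exact thin_of_smaller hH fun s hs hsH => ih s.size hs hsH rfl

end HTree

/-! ### Bad and semi-bad roots. -/

/-- The numerical estimate behind a root with two heavy leaves and a strip which is not thin. -/
lemma fat_strip_real {a d x h : ℝ} (ha : 0 < a) (hd : 0 < d) (hh : 0 < h) (hax : a ≤ x)
    (had : 2 * d ^ 2 ≤ a ^ 2) (hda : a ^ 2 ≤ 8 * d ^ 2) (hx : x ^ 2 ≤ 2 * (a ^ 2 + d ^ 2))
    (hS : h ^ 2 ≤ a ^ 2 + d ^ 2 + x ^ 2) (hS3 : a ^ 2 + d ^ 2 + x ^ 2 ≤ 3 * h ^ 2) :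
    (a ^ 2 + d ^ 2 ≤ h ^ 2 →
      (x ^ 2 + 2 * (a ^ 2 + d ^ 2)) / h + (2 + d ^ 2 / (a ^ 2 + d ^ 2)) * h
        ≤ 2.406 * (a + d + x)) ∧
    (h ^ 2 ≤ a ^ 2 + d ^ 2 →
      (x ^ 2 + a ^ 2 + 2 * d ^ 2) / h + 3 * h ≤ 2.406 * (a + d + x)) := by
  have hx0 : 0 < x := by linarith
  obtain ⟨p, hp, hp2⟩ : ∃ p, 0 < p ∧ p ^ 2 = a ^ 2 + d ^ 2 :=
    ⟨√(a ^ 2 + d ^ 2), Real.sqrt_pos.2 (by positivity), Real.sq_sqrt (by positivity)⟩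
  obtain ⟨T, hT, hT2⟩ : ∃ T, 0 < T ∧ T ^ 2 = p ^ 2 + x ^ 2 :=
    ⟨√(p ^ 2 + x ^ 2), Real.sqrt_pos.2 (by positivity), Real.sq_sqrt (by positivity)⟩
  have d0 : 0.3535 * a ≤ d := by nlinarith
  have d1 : d ≤ 0.7072 * a := by nlinarith
  have x1 : x ≤ 1.7325 * a := by nlinarith
  have x2 : x ≤ 1.33 * a + 0.57 * d := by nlinarith
  -- Cauchy–Schwarz with a vector of length just below one; `hTl` is the same in three variables.
  have hpl : 0.8836 * a + 0.468 * d ≤ p := by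
    refine le_of_sq_le ?_ hp.le
    rw [hp2]; nlinarith [sq_nonneg (0.468 * a - 0.8836 * d)]
  have hTl : 0.58 * a + 0.3075 * d + 0.754 * x ≤ T := by
    refine le_of_sq_le ?_ hT.le
    rw [hT2, hp2]
    nlinarith [sq_nonneg (0.3075 * a - 0.58 * d), sq_nonneg (0.754 * a - 0.58 * x),
      sq_nonneg (0.754 * d - 0.3075 * x)]
  have hR0 : 0 ≤ 2.406 * (a + d + x) := by positivity
  have m1 := mul_nonneg (sub_nonneg.2 d0) (sub_nonneg.2 d1)
  have m2 := mul_nonneg (sub_nonneg.2 hax) (sub_nonneg.2 x1)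
  have m3 := mul_nonneg (sub_nonneg.2 d0) (sub_nonneg.2 hax)
  have m4 := mul_nonneg (sub_nonneg.2 d1) (sub_nonneg.2 hax)
  have m5 := mul_nonneg (sub_nonneg.2 hax) (sub_nonneg.2 x2)
  have m6 := mul_nonneg ha.le (sub_nonneg.2 hax)
  have m7 := mul_nonneg ha.le (sub_nonneg.2 d0)
  have m8 := mul_nonneg ha.le (sub_nonneg.2 d1)
  have e1 : 3.3334 * x ^ 2 + 4 * p ^ 2 + d ^ 2 ≤ 2.406 * (a + d + x) * T := by
    refine le_trans ?_ (mul_le_mul_of_nonneg_left hTl hR0)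
    rw [hp2]
    nlinarith
  have e2 : x ^ 2 + 4 * p ^ 2 + d ^ 2 ≤ 2.406 * (a + d + x) * p := by
    refine le_trans ?_ (mul_le_mul_of_nonneg_left hpl hR0)
    rw [hp2]
    nlinarith
  have e3 : (2 * T ^ 2 + d ^ 2) * 1.73206 ≤ 2.406 * (a + d + x) * T := by
    refine le_trans ?_ (mul_le_mul_of_nonneg_left hTl hR0)
    rw [hT2, hp2]
    nlinarith
  rw [← hp2] at hS hS3 ⊢
  rw [← hT2] at hS hS3
  constructor
  · intro h'
    refine div_add_mul_le_of_endpoints (by positivity) hp (le_of_sq_le h' hh.le)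
      (h₁ := T) (le_of_sq_le hS hT.le) ?_ ?_
    · have : d ^ 2 / p ^ 2 * p ^ 2 = d ^ 2 := by field_simp
      linarith
    · have h1 : d ^ 2 / p ^ 2 ≤ 1 / 3 := by
        rw [div_le_iff₀ (by positivity), hp2]; linarith
      have h2 : d ^ 2 / p ^ 2 * T ^ 2 ≤ d ^ 2 + 1 / 3 * x ^ 2 := by
        have : d ^ 2 / p ^ 2 * T ^ 2 = d ^ 2 + d ^ 2 / p ^ 2 * x ^ 2 := by
          rw [hT2]; field_simp
        rw [this]
        linarith [mul_le_mul_of_nonneg_right h1 (sq_nonneg x)]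
      linarith [sq_nonneg x]
  · intro h'
    obtain ⟨t1, t2, t3⟩ := div_sqrt_three_bounds hT
    refine div_add_mul_le_of_endpoints (by norm_num) t1
      (le_of_sq_le (by linarith) hh.le) (h₁ := p) (le_of_sq_le h' hp.le) ?_ ?_
    · rw [t2]
      have h5 := mul_le_mul_of_nonneg_left t3 hR0
      linarith
    · linarith

/-- The numerical estimate behind a root with two heavy leaves, compared with partitions in which
one of the heavy rectangles lies above the other. -/
lemma stacked_real {p x a h : ℝ} (ha : 0 < a) (hh : 0 < h) (hap : a ≤ p) (hax : a ≤ x)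
    (h23 : 2 * p ^ 2 ≤ 3 * a ^ 2) (hx : x ^ 2 ≤ 2 * p ^ 2) (hS : h ^ 2 ≤ p ^ 2 + x ^ 2) :
    (p ^ 2 ≤ h ^ 2 →
      (2 * p ^ 2 + x ^ 2) / h + 2 * h - 4.146 * (p - a) ≤ 1.203 * (h + (a + x) ^ 2 / h)) ∧
    (h ^ 2 ≤ p ^ 2 →
      (p ^ 2 + x ^ 2) / h + 3 * h - 4.146 * (p - a) ≤ 1.203 * (h + (a + x) ^ 2 / h)) := by
  have hp : 0 < p := by linarith
  have hx0 : 0 < x := by linarith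
  have hpa : 0.8164 * p ≤ a := by nlinarith
  have hx1 : x ≤ 1.41422 * p := by nlinarith
  have hxp : 0.8164 * p ≤ x := by linarith
  have m1 := mul_nonneg (sub_nonneg.2 hpa) (sub_nonneg.2 hap)
  have m2 := mul_nonneg (sub_nonneg.2 hax) (sub_nonneg.2 hx1)
  have m3 := mul_nonneg (sub_nonneg.2 hpa) (sub_nonneg.2 hax)
  have m4 := mul_nonneg (sub_nonneg.2 hap) (sub_nonneg.2 hax)
  have m5 := mul_nonneg hp.le (sub_nonneg.2 hap)
  have m6 := mul_nonneg hp.le (sub_nonneg.2 hpa)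
  have m7 := mul_nonneg hp.le (sub_nonneg.2 hax)
  constructor
  · intro h'
    have hph : p ≤ h := le_of_sq_le h' hh.le
    obtain ⟨T, hT, hT2⟩ : ∃ T, 0 < T ∧ T ^ 2 = p ^ 2 + x ^ 2 :=
      ⟨√(p ^ 2 + x ^ 2), Real.sqrt_pos.2 (by positivity), Real.sq_sqrt (by positivity)⟩
    have hhT : h ≤ T := le_of_sq_le (by linarith) hT.le
    have hTp : 1.29 * p ≤ T := le_of_sq_le (by rw [hT2]; nlinarith) hT.le
    have e1 : 0.797 * h ^ 2 - 4.146 * (p - a) * h ≤ 0.797 * T ^ 2 - 4.146 * (p - a) * T := by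
      have : 0 ≤ (T - h) * (0.797 * (T + h) - 4.146 * (p - a)) :=
        mul_nonneg (by linarith) (by linarith)
      linarith
    have e2 := mul_le_mul_of_nonneg_left hTp (by linarith : 0 ≤ 4.146 * (p - a))
    have e3 : x ^ 2 + 2 * p ^ 2 + 0.797 * (p ^ 2 + x ^ 2) - 4.146 * (p - a) * (1.29 * p)
        ≤ 1.203 * (a + x) ^ 2 := by
      nlinarith
    have key : 2 * p ^ 2 + x ^ 2 + 2 * h ^ 2 - 4.146 * (p - a) * h
        ≤ 1.203 * (h ^ 2 + (a + x) ^ 2) := by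
      rw [hT2] at e1
      linarith
    have e : 1.203 * (h + (a + x) ^ 2 / h) - ((2 * p ^ 2 + x ^ 2) / h + 2 * h - 4.146 * (p - a))
        = (1.203 * (h ^ 2 + (a + x) ^ 2)
          - (2 * p ^ 2 + x ^ 2 + 2 * h ^ 2 - 4.146 * (p - a) * h)) / h := by
      field_simp
    rw [← sub_nonneg, e]
    exact div_nonneg (by linarith) hh.le
  · intro h'
    have hph : h ≤ p := le_of_sq_le h' hp.le
    have e1 : 1.797 * h ^ 2 - 4.146 * (p - a) * h ≤ 1.797 * p ^ 2 - 4.146 * (p - a) * p := by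
      have : 0 ≤ (p - h) * (1.797 * (p + h) - 4.146 * (p - a)) :=
        mul_nonneg (by linarith) (by linarith)
      linarith
    have e3 : x ^ 2 + p ^ 2 + 1.797 * p ^ 2 - 4.146 * (p - a) * p ≤ 1.203 * (a + x) ^ 2 := by
      nlinarith
    have e : 1.203 * (h + (a + x) ^ 2 / h) - ((p ^ 2 + x ^ 2) / h + 3 * h - 4.146 * (p - a))
        = (1.203 * (h ^ 2 + (a + x) ^ 2)
          - (p ^ 2 + x ^ 2 + 3 * h ^ 2 - 4.146 * (p - a) * h)) / h := by
      field_simp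
    rw [← sub_nonneg, e]
    exact div_nonneg (by linarith) hh.le

namespace HTree

/-- The cost of a strip compared with the lower bound from its shorter side. -/
lemma Huff.strip_cost {s : HTree} (hH : s.Huff) {h : ℝ} (hh : 0 < h) (h1 : s.wt ≤ h ^ 2) :
    (3 * s.wt ≤ h ^ 2 → s.cost h ≤ 1.203 * s.lb (s.wt / h) + 0.4 * (s.wt / h)) ∧
    (h ^ 2 ≤ 3 * s.wt → s.cost h ≤ 2.406 * s.sig + h + 2 * (s.wt / h) - 2.406 * √s.wt) := by
  have hs0 := hH.wt_pos
  have e : s.wt / (s.wt / h) = h := by field_simp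
  have hz : 0 < s.wt / h := by positivity
  rw [← cost_swap hs0 hh]
  constructor
  · intro h2
    refine (hH.thinBound _ hz ?_).2
    rw [div_pow, ← mul_div_assoc, div_le_iff₀ (by positivity)]; nlinarith
  · intro h2
    have c := hH.fat hz (by rw [div_pow, div_le_iff₀ (by positivity)]; nlinarith)
      (by rw [div_pow, ← mul_div_assoc, le_div_iff₀ (by positivity)]; nlinarith)
    rwa [e] at c

/-- A strip at least `h` wide is handled by `bad_thin` without error. For a narrower one, the
hypothesis `hO` charges all other rectangles with the short side `s.wt / h`, which matches the strip
used by the algorithm. -/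
lemma root_bad {t s : HTree} {a h O : ℝ} (hs : t.Splits (leaf a) s) (hH : t.Huff)
    (h2 : 2 * s.wt < a) (hh : 0 < h) (h1 : h ^ 2 ≤ t.wt) (h0 : t.lb h ≤ O)
    (hO : s.wt ≤ h ^ 2 → minPerim h a + s.lb (s.wt / h) ≤ O) : t.cost h ≤ 1.203 * O := by
  have hsH := (hs.huff hH).2.1
  have hs0 := hsH.wt_pos
  have hw : t.wt = a + s.wt := hs.wt
  have ha0 : 0 < a := by linarith
  have hh2 : 0 < h ^ 2 := by positivity
  rcases le_total (h ^ 2) s.wt with h3 | h3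
  · have c := (bad_thin hs hH h2 hsH.thinBound hh (by linarith)).2 h3
    linarith
  replace hO := hO h3
  obtain ⟨c1, c2⟩ := hsH.strip_cost hh h3
  have hz : 0 < s.wt / h := by positivity
  have hlb := hsH.two_sig_le_lb hz
  rw [hs.cost hh h1, cost_leaf]
  have hfat : h ^ 2 ≤ 3 * s.wt → 0.57735 * h ≤ √s.wt ∧ √s.wt ≤ h := fun h4 =>
    ⟨Real.le_sqrt_of_sq_le (by nlinarith), Real.sqrt_le_iff.2 ⟨hh.le, h3⟩⟩
  rcases le_total (h ^ 2) a with h5 | h5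
  · rw [minPerim_eq hh h5] at hO
    rcases le_total (3 * s.wt) (h ^ 2) with h4 | h4
    · have c := c1 h4
      have e1 : s.wt / h ≤ h / 3 := by rw [div_le_iff₀ hh]; nlinarith
      have e2 : h ≤ a / h := by rw [le_div_iff₀ hh]; nlinarith
      linarith
    · have c := c2 h4
      obtain ⟨g1, g2⟩ := hfat h4
      have e2 : 2 * (s.wt / h) ≤ a / h := by rw [← mul_div_assoc]; gcongr
      have : 0.797 * h + 1.594 * (s.wt / h) ≤ 2.406 * √s.wt := by
        nth_rw 1 [← Real.sq_sqrt hs0.le]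
        set r := √s.wt
        have e : 2.406 * r - (0.797 * h + 1.594 * (r ^ 2 / h))
            = (2.406 * r * h - 1.594 * r ^ 2 - 0.797 * h ^ 2) / h := by field_simp; ring
        rw [← sub_nonneg, e]
        apply div_nonneg _ hh.le
        nlinarith [mul_nonneg (sub_nonneg.2 g1) (sub_nonneg.2 g2)]
      linarith
  · rw [minPerim, if_pos h5] at hO
    have hr2 := Real.sq_sqrt ha0.le
    have hr1 : √a ≤ h := Real.sqrt_le_iff.2 ⟨hh.le, h5⟩
    have hr0 : 0.8164 * h ≤ √a := Real.le_sqrt_of_sq_le (by nlinarith)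
    have key : h + a / h + 0.2977 * h + 0.58 * (√a - 0.8164 * h) ≤ 2.406 * √a := by
      nth_rw 1 [← hr2]
      set r := √a
      have e : 2.406 * r - (h + r ^ 2 / h + 0.2977 * h + 0.58 * (r - 0.8164 * h))
          = (2.406 * r * h - h ^ 2 - r ^ 2 - 0.2977 * h ^ 2 - 0.58 * (r - 0.8164 * h) * h) / h := by
        field_simp; ring
      rw [← sub_nonneg, e]
      apply div_nonneg _ hh.le
      nlinarith [mul_nonneg (sub_nonneg.2 hr0) (sub_nonneg.2 hr1)]
    rcases le_total (3 * s.wt) (h ^ 2) with h4 | h4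
    · have c := c1 h4
      have e1 : s.wt / h ≤ h / 3 := by rw [div_le_iff₀ hh]; nlinarith
      linarith
    · have c := c2 h4
      obtain ⟨g1, g2⟩ := hfat h4
      have g3 : 1.4142 * √s.wt ≤ √a := by
        refine Real.le_sqrt_of_sq_le ?_
        rw [mul_pow, Real.sq_sqrt hs0.le]; linarith
      have : h + 2 * (s.wt / h) - 2.406 * √s.wt ≤ 0.2977 * h + 0.58 * (√a - 0.8164 * h) := by
        have g4 : √s.wt ≤ 0.7072 * h := by linarith
        nth_rw 1 [← Real.sq_sqrt hs0.le]
        set r := √s.wt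
        have e : 0.2977 * h + 0.58 * (√a - 0.8164 * h) - (h + 2 * (r ^ 2 / h) - 2.406 * r)
            = (0.2977 * h ^ 2 + 0.58 * (√a - 0.8164 * h) * h - h ^ 2 - 2 * r ^ 2
              + 2.406 * r * h) / h := by
          field_simp; ring
        rw [← sub_nonneg, e]
        apply div_nonneg _ hh.le
        nlinarith [mul_nonneg (sub_nonneg.2 g1) (sub_nonneg.2 g4),
          mul_le_mul_of_nonneg_right g3 hh.le]
      linarith

/-- If the strip of `s` has aspect ratio at most three, the bound from the areas suffices. Otherwise
the alternative in `hO` is used with `z` the width of this strip. -/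
lemma root_semi {t b s : HTree} {a x h O : ℝ} (hq : t.Splits b (leaf x)) (hH : t.Huff)
    (hb : b.Splits (leaf a) s) (h2 : 2 * s.wt < a) (hx : x ≤ 2 * b.wt) (hh : 0 < h)
    (h1 : h ^ 2 ≤ t.wt) (h3 : t.wt ≤ 3 * h ^ 2) (h0 : t.lb h ≤ O)
    (hO : ∀ z, s.wt / h ≤ z → s.wt * h / b.wt ≤ z →
      2 * √x + 2 * √a + s.lb z ≤ O ∨ h + (√a + √x) ^ 2 / h + 2 * s.sig ≤ O) :
    t.cost h ≤ 1.203 * O := by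
  obtain ⟨hbH, hx0, -⟩ := hq.huff hH
  replace hx0 : 0 < x := hx0
  have hsH := (hb.huff hbH).2.1
  have hs0 := hsH.wt_pos
  have hax := Semi.bounds hH hq hb h2
  have hbw : b.wt = a + s.wt := hb.wt
  have htw : t.wt = b.wt + x := hq.wt
  have ha0 : 0 < a := by linarith
  have hb0 : 0 < b.wt := by linarith
  have hlbt := hH.two_sig_le_lb hh
  -- Here `m` is the shorter side of the piece of `b`, so the strip of `s` has width `s.wt / m`.
  obtain ⟨m, hm, hmb, hmb3, hmc, hmz⟩ : ∃ m, 0 < m ∧ m ^ 2 ≤ b.wt ∧ b.wt ≤ 3 * m ^ 2 ∧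
      b.cost h = b.cost m ∧ ((m = h ∧ h ^ 2 ≤ b.wt) ∨ (m = b.wt / h ∧ b.wt ≤ h ^ 2)) := by
    rcases le_total (h ^ 2) b.wt with h4 | h4
    · exact ⟨h, hh, h4, by linarith, rfl, Or.inl ⟨rfl, h4⟩⟩
    · refine ⟨b.wt / h, by positivity, ?_, ?_, (cost_swap hb0 hh).symm, Or.inr ⟨rfl, h4⟩⟩
      · rw [div_pow, div_le_iff₀ (by positivity)]; nlinarith
      · rw [div_pow, ← mul_div_assoc, le_div_iff₀ (by positivity)]; nlinarith
  have hsm : s.wt ≤ m ^ 2 := by linarith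
  obtain ⟨c1, c2⟩ := hsH.strip_cost hm hsm
  have hz0 : 0 < s.wt / m := by positivity
  have cb : t.cost h = m + a / m + s.cost m + (h + x / h) := by
    rw [hq.cost hh h1, hmc, hb.cost hm hmb, cost_leaf, cost_leaf]
  rcases le_total (m ^ 2) (3 * s.wt) with h4 | h4
  · have c := c2 h4
    have r := fat_strip_real (a := √a) (d := √s.wt) (x := √x) (h := h) (Real.sqrt_pos.2 ha0)
      (Real.sqrt_pos.2 hs0) hh (Real.sqrt_le_sqrt hax)
    rw [Real.sq_sqrt ha0.le, Real.sq_sqrt hs0.le, Real.sq_sqrt hx0.le, ← hbw, ← htw] at r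
    obtain ⟨r1, r2⟩ := r h2.le (by linarith) hx h1 h3
    have hsig : t.sig = √a + s.sig + √x := by rw [hq.sig, hb.sig]; rfl
    have e : a / m + 2 * (s.wt / m) + 2 * m + (h + x / h) ≤ 2.406 * (√a + √s.wt + √x) := by
      rcases hmz with ⟨rfl, h5⟩ | ⟨rfl, h5⟩
      · refine le_trans (le_of_eq ?_) (r2 h5)
        ring
      · refine le_trans (le_of_eq ?_) (r1 h5)
        rw [hbw]
        have : a + s.wt ≠ 0 := by linarith
        field_simp
        ring
    rw [cb]
    linarith
  have hz1 : s.wt / h ≤ s.wt / m ∧ s.wt * h / b.wt ≤ s.wt / m := by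
    rcases hmz with ⟨rfl, h5⟩ | ⟨rfl, h5⟩
    · refine ⟨le_rfl, ?_⟩
      rw [div_le_div_iff₀ hb0 hh]; nlinarith
    · have : s.wt / (b.wt / h) = s.wt * h / b.wt := by field_simp
      rw [this]
      refine ⟨?_, le_rfl⟩
      rw [div_le_div_iff₀ hh hb0]; nlinarith
  rcases hO _ hz1.1 hz1.2 with hO | hO
  -- The error `0.4 (s.wt / m)` is at most `0.4 m / 3`, less than the saving `0.0965 (√a + √x)` of
  -- the two leaves.
  · have c := c1 h4
    have l1 := leaf_cost_le hx0 hh (by linarith) (by linarith)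
    have l2 := leaf_cost_le ha0 hm (by linarith) (by linarith)
    have l3 : √a ≤ √x := Real.sqrt_le_sqrt hax
    have l4 : m ≤ 1.2248 * √a := by
      refine le_of_sq_le ?_ (by positivity)
      rw [mul_pow, Real.sq_sqrt ha0.le]; linarith
    have l5 : s.wt / m ≤ m / 3 := by rw [div_le_iff₀ hm]; nlinarith
    rw [cb]
    linarith
  · obtain ⟨d1, d2⟩ := hb.badBound hbH h2 hsH.bounds.1 h hh (by linarith) (by linarith)
    have hbsig : b.sig = √a + s.sig := by rw [hb.sig]; rfl
    have r := stacked_real (p := √b.wt) (x := √x) (a := √a) (h := h) (Real.sqrt_pos.2 ha0) hh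
      (Real.sqrt_le_sqrt (by linarith)) (Real.sqrt_le_sqrt hax)
    rw [Real.sq_sqrt ha0.le, Real.sq_sqrt hb0.le, Real.sq_sqrt hx0.le, ← htw] at r
    obtain ⟨r1, r2⟩ := r (by linarith) hx h1
    rw [hq.cost hh h1, cost_leaf]
    rcases hmz with ⟨-, h5⟩ | ⟨-, h5⟩
    · have r := r2 h5
      have e : t.wt / h = b.wt / h + x / h := by rw [htw, add_div]
      linarith
    · have r := r1 h5
      rw [add_div] at r
      linarith

/-- The cost of a Huffman tree is at most `1.203` times any number that is subject to the lower
bounds for partitions of a rectangle with shorter side `h`. -/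
theorem Huff.cost_le {t : HTree} (hH : t.Huff) {h O : ℝ} (hh : 0 < h) (h1 : h ^ 2 ≤ t.wt)
    (h0 : t.lb h ≤ O)
    (hbad : ∀ a s, t.Splits (leaf a) s → s.wt ≤ h ^ 2 → minPerim h a + s.lb (s.wt / h) ≤ O)
    (hsemi : ∀ b x a s, t.Splits b (leaf x) → b.Splits (leaf a) s → a ≤ x → 2 * s.wt < a →
      ∀ z, s.wt / h ≤ z → s.wt * h / b.wt ≤ z →
      2 * √x + 2 * √a + s.lb z ≤ O ∨ h + (√a + √x) ^ 2 / h + 2 * s.sig ≤ O) :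
    t.cost h ≤ 1.203 * O := by
  by_cases hb : t.Bad
  · obtain ⟨a, s, hs, h2⟩ := hb
    exact root_bad hs hH h2 hh h1 h0 (hbad a s hs)
  rcases le_total t.wt (3 * h ^ 2) with h3 | h3
  · by_cases hse : t.Semi
    · obtain ⟨b, x, hq, ⟨a, s, hk, h2⟩, hx⟩ := hse
      exact root_semi hq hH hk h2 hx hh h1 h3 h0
        (hsemi b x a s hq hk (Semi.bounds hH hq hk h2) h2)
    · have := hH.bounds.2 hb hse h hh h1 h3
      have := hH.two_sig_le_lb hh
      linarith
  · have := (hH.thinBound h hh h3).1 hb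
    linarith

end HTree

/-! ### Lower bounds for arbitrary packings. -/

/-- Rectangles `[X i, X i + W i] × [Y i, Y i + H i]` of areas `A i` packed without overlaps into
`[0, L] × [0, M]`. -/
structure Packing {n : ℕ} (L M : ℝ) (A X Y W H : Fin n → ℝ) : Prop where
  w_pos : ∀ i, 0 < W i
  h_pos : ∀ i, 0 < H i
  area : ∀ i, W i * H i = A i
  memX : ∀ i, 0 ≤ X i ∧ X i + W i ≤ L
  memY : ∀ i, 0 ≤ Y i ∧ Y i + H i ≤ M
  sep : ∀ i j, i ≠ j → (X i + W i ≤ X j ∨ X j + W j ≤ X i) ∨ (Y i + H i ≤ Y j ∨ Y j + H j ≤ Y i)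

lemma Rect.interior_toSet (Q : Rect) :
    interior Q.toSet = Set.Ioo Q.x (Q.x + Q.w) ×ˢ Set.Ioo Q.y (Q.y + Q.h) := by
  rw [Rect.toSet, interior_prod_eq, interior_Icc, interior_Icc]

lemma IsPartition.packing {n : ℕ} {R : Rect} {A : Fin n → ℝ} {P : Fin n → Rect}
    (h : IsPartition R A P) :
    Packing R.w R.h A (fun i => (P i).x - R.x) (fun i => (P i).y - R.y) (fun i => (P i).w)
      (fun i => (P i).h) := by
  have hsub : ∀ i, (R.x ≤ (P i).x ∧ (P i).x + (P i).w ≤ R.x + R.w) ∧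
      (R.y ≤ (P i).y ∧ (P i).y + (P i).h ≤ R.y + R.h) := by
    intro i
    obtain ⟨hw, hh⟩ := h.nondegenerate i
    have hs : (P i).toSet ⊆ R.toSet := by
      rw [← h.iUnion_eq]; exact Set.subset_iUnion (fun i => (P i).toSet) i
    have h1 : ((P i).x, (P i).y) ∈ R.toSet :=
      hs ⟨⟨le_rfl, by simp [hw.le]⟩, ⟨le_rfl, by simp [hh.le]⟩⟩
    have h2 : ((P i).x + (P i).w, (P i).y + (P i).h) ∈ R.toSet :=
      hs ⟨⟨by simp [hw.le], le_rfl⟩, ⟨by simp [hh.le], le_rfl⟩⟩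
    exact ⟨⟨h1.1.1, h2.1.2⟩, ⟨h1.2.1, h2.2.2⟩⟩
  refine ⟨fun i => (h.nondegenerate i).1, fun i => (h.nondegenerate i).2, fun i => h.area_eq i,
    fun i => ⟨by linarith [(hsub i).1.1], by linarith [(hsub i).1.2]⟩,
    fun i => ⟨by linarith [(hsub i).2.1], by linarith [(hsub i).2.2]⟩, fun i j hij => ?_⟩
  by_contra! hc
  obtain ⟨⟨c1, c2⟩, c3, c4⟩ := hc
  obtain ⟨hwi, hhi⟩ := h.nondegenerate i
  obtain ⟨hwj, hhj⟩ := h.nondegenerate j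
  have hd := h.disjoint_interior i j hij
  rw [Rect.interior_toSet, Rect.interior_toSet] at hd
  have ex : ∃ u, u ∈ Set.Ioo (P i).x ((P i).x + (P i).w) ∧
      u ∈ Set.Ioo (P j).x ((P j).x + (P j).w) := by
    obtain ⟨u, h1, h2⟩ := exists_between (a₁ := max (P i).x (P j).x)
      (a₂ := min ((P i).x + (P i).w) ((P j).x + (P j).w))
      (by rw [max_lt_iff, lt_min_iff, lt_min_iff]; exact ⟨⟨by linarith, by linarith⟩,
        by linarith, by linarith⟩)
    rw [max_lt_iff] at h1
    rw [lt_min_iff] at h2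
    exact ⟨u, ⟨h1.1, h2.1⟩, h1.2, h2.2⟩
  have ey : ∃ u, u ∈ Set.Ioo (P i).y ((P i).y + (P i).h) ∧
      u ∈ Set.Ioo (P j).y ((P j).y + (P j).h) := by
    obtain ⟨u, h1, h2⟩ := exists_between (a₁ := max (P i).y (P j).y)
      (a₂ := min ((P i).y + (P i).h) ((P j).y + (P j).h))
      (by rw [max_lt_iff, lt_min_iff, lt_min_iff]; exact ⟨⟨by linarith, by linarith⟩,
        by linarith, by linarith⟩)
    rw [max_lt_iff] at h1
    rw [lt_min_iff] at h2
    exact ⟨u, ⟨h1.1, h2.1⟩, h1.2, h2.2⟩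
  obtain ⟨u, u1, u2⟩ := ex
  obtain ⟨v, v1, v2⟩ := ey
  exact Set.disjoint_left.1 hd (show (u, v) ∈ _ from ⟨u1, v1⟩) ⟨u2, v2⟩

namespace Packing

variable {n : ℕ} {L M : ℝ} {A X Y W H : Fin n → ℝ}

lemma swap (h : Packing L M A X Y W H) : Packing M L A Y X H W :=
  ⟨h.h_pos, h.w_pos, fun i => by rw [mul_comm]; exact h.area i, h.memY, h.memX,
    fun i j hij => (h.sep i j hij).symm⟩

lemma area_pos (h : Packing L M A X Y W H) (i : Fin n) : 0 < A i := by
  rw [← h.area i]; exact mul_pos (h.w_pos i) (h.h_pos i)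

lemma w_le (h : Packing L M A X Y W H) (i : Fin n) : W i ≤ L := by
  linarith [(h.memX i).1, (h.memX i).2]

lemma div_le_w (h : Packing L M A X Y W H) (i : Fin n) : A i / M ≤ W i := by
  have := h.h_pos i
  have := h.swap.w_le i
  rw [div_le_iff₀ (by linarith), ← h.area i]
  exact mul_le_mul_of_nonneg_left this (h.w_pos i).le

lemma w_add_w_le (h : Packing L M A X Y W H) {i j : Fin n}
    (hs : X i + W i ≤ X j ∨ X j + W j ≤ X i) : W i + W j ≤ L := by
  have := h.memX i
  have := h.memX j
  rcases hs with hs | hs <;> linarith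

lemma minPerim_le_perim (h : Packing L M A X Y W H) {i : Fin n} {v : ℝ}
    (hv : W i ≤ v ∨ H i ≤ v) : minPerim v (A i) ≤ W i + H i := by
  rcases hv with hv | hv
  · exact minPerim_le (h.w_pos i) (h.h_pos i) (h.area i) hv
  · rw [add_comm]
    exact minPerim_le (h.h_pos i) (h.w_pos i) (by rw [mul_comm]; exact h.area i) hv

/-- In the presence of a heavy rectangle, the others have a short side. -/
lemma short_side (h : Packing L M A X Y W H) (hML : M ≤ L) {i j : Fin n} (hij : i ≠ j) :
    W i ≤ (L * M - A j) / M ∨ H i ≤ (L * M - A j) / M := by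
  have hM : 0 < M := (h.h_pos i).trans_le (h.swap.w_le i)
  have hL : 0 < L := hM.trans_le hML
  have e : (L * M - A j) / M = L - A j / M := by field_simp
  rcases h.sep i j hij with hs | hs
  · left
    rw [e]
    linarith [h.w_add_w_le hs, h.div_le_w j]
  · right
    have h1 : H i ≤ (L * M - A j) / L := by
      have : (L * M - A j) / L = M - A j / L := by field_simp
      rw [this]
      linarith [h.swap.w_add_w_le hs, h.swap.div_le_w j]
    refine h1.trans (div_le_div_of_nonneg_left ?_ hM hML)
    by_contra! hneg
    have := div_neg_of_neg_of_pos hneg hL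
    linarith [h.h_pos i]

/-- In the presence of two heavy rectangles side by side, the others have a short side. -/
lemma short_side₂ (h : Packing L M A X Y W H) {i j k : Fin n} (hij : i ≠ j) (hik : i ≠ k)
    (hjk : X j + W j ≤ X k ∨ X k + W k ≤ X j) (hA : A j ≤ A k) {e z : ℝ} (he : 0 ≤ e)
    (hS : A j + A k + e = L * M) (h1 : e / M ≤ z) (h2 : e * M / (A j + e) ≤ z) :
    W i ≤ z ∨ H i ≤ z := by
  have hM : 0 < M := (h.h_pos i).trans_le (h.swap.w_le i)
  have hj := h.area_pos j
  -- Beside `k`, rectangle `j` has width at most `(A j + e) / M`, hence a large height, which limits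
  -- the height of anything above or below it.
  have key : ∀ j k, A j + A k + e = L * M → e * M / (A j + e) ≤ z → W j + W k ≤ L →
      H i + H j ≤ M → H i ≤ z := by
    intro j k hS h2 hjk hij
    refine le_trans ?_ h2
    have hj := h.area_pos j
    rw [le_div_iff₀ (by linarith)]
    have hwj : W j ≤ (A j + e) / M := by
      have e1 : (A j + e) / M = L - A k / M := by
        rw [eq_sub_iff_add_eq, ← add_div, div_eq_iff hM.ne']; linarith
      linarith [h.div_le_w k]
    rw [le_div_iff₀ hM] at hwj
    have e2 := h.area j
    have h3 := h.w_pos j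
    have h4 := h.h_pos j
    have h5 := h.h_pos i
    have h6 : A j * M ≤ (A j + e) * H j := by
      rw [← e2, e2]
      calc A j * M = W j * M * H j := by rw [← e2]; ring
        _ ≤ (A j + e) * H j := mul_le_mul_of_nonneg_right hwj h4.le
    nlinarith
  have hw := h.w_add_w_le hjk
  rcases h.sep i j hij with hsj | hsj
  · rcases h.sep i k hik with hsk | hsk
    · left
      refine le_trans ?_ h1
      have e1 : e / M = L - A j / M - A k / M := by
        rw [sub_sub, ← add_div, eq_sub_iff_add_eq, ← add_div, div_eq_iff hM.ne']; linarith
      have h3 : W i + W j + W k ≤ L := by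
        have := h.memX i
        have := h.memX j
        have := h.memX k
        have := h.w_pos i
        have := h.w_pos j
        have := h.w_pos k
        rcases hsj with hsj | hsj <;> rcases hsk with hsk | hsk <;> rcases hjk with hjk | hjk <;>
          linarith
      linarith [h.div_le_w j, h.div_le_w k]
    · right
      have h3 : e * M / (A k + e) ≤ e * M / (A j + e) := by gcongr
      exact key k j (by linarith) (h3.trans h2) (by linarith) (h.swap.w_add_w_le hsk)
  · right
    exact key j k hS h2 hw (h.swap.w_add_w_le hsj)

/-- Two heavy rectangles on top of each other have a large perimeter. -/
lemma stacked (h : Packing L M A X Y W H) (hML : M ≤ L) {j k : Fin n}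
    (hjk : H j + H k ≤ M) (hA : A j ≤ A k) {e : ℝ} (hS : A j + A k + e = L * M)
    (he : e ≤ 2 * A j) :
    M + (√(A j) + √(A k)) ^ 2 / M ≤ W j + H j + (W k + H k) := by
  have hj := h.area_pos j
  have hk := h.area_pos k
  have h1 := h.h_pos j
  have h2 := h.h_pos k
  have hM : 0 < M := by linarith
  have ej : W j = √(A j) ^ 2 / H j := by rw [Real.sq_sqrt hj.le, ← h.area j]; field_simp
  have ek : W k = √(A k) ^ 2 / H k := by rw [Real.sq_sqrt hk.le, ← h.area k]; field_simp
  -- Indeed `M ^ 2 ≤ L * M ≤ 3 A j + A k`, and `A j ≤ √(A j) √(A k)`.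
  have hK : M ^ 2 ≤ (√(A j) + √(A k)) ^ 2 := by
    have h3 : √(A j) ≤ √(A k) := Real.sqrt_le_sqrt hA
    have h4 := Real.sq_sqrt hj.le
    have h5 := Real.sq_sqrt hk.le
    nlinarith [Real.sqrt_nonneg (A j)]
  set u := √(A j)
  set v := √(A k)
  -- Cauchy–Schwarz. Afterwards `T + (u + v) ^ 2 / T` decreases for `T ≤ M ≤ u + v`.
  have h3 : (u + v) ^ 2 / (H j + H k) ≤ W j + W k := by
    rw [ej, ek]
    rw [div_add_div _ _ h1.ne' h2.ne', div_le_div_iff₀ (by positivity) (by positivity)]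
    nlinarith [mul_nonneg (sq_nonneg (u * H k - v * H j)) (le_refl (0 : ℝ)),
      sq_nonneg (u * H k - v * H j)]
  set T := H j + H k with hT
  have hT0 : 0 < T := by positivity
  have h4 : M + (u + v) ^ 2 / M ≤ T + (u + v) ^ 2 / T := by
    have : T + (u + v) ^ 2 / T - (M + (u + v) ^ 2 / M)
        = (M - T) * ((u + v) ^ 2 - M * T) / (M * T) := by field_simp; ring
    rw [← sub_nonneg, this]
    have : 0 ≤ (u + v) ^ 2 - M * T := by nlinarith
    have : 0 ≤ M - T := by linarith
    positivity
  linarith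

end Packing

lemma exists_erase_of_map_eq_cons {n : ℕ} {A : Fin n → ℝ} {s : Finset (Fin n)} {a : ℝ}
    {N : Multiset ℝ} (h : a ::ₘ N = s.val.map A) :
    ∃ i ∈ s, A i = a ∧ N = (s.erase i).val.map A := by
  have : a ∈ s.val.map A := by rw [← h]; exact Multiset.mem_cons_self _ _
  obtain ⟨i, hi, rfl⟩ := Multiset.mem_map.1 this
  refine ⟨i, hi, rfl, ?_⟩
  have e : s.val = i ::ₘ (s.erase i).val := by
    rw [Finset.erase_val, Multiset.cons_erase hi]
  rw [e, Multiset.map_cons] at h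
  exact (Multiset.cons_inj_right _).1 h

/-- The cost of a Huffman tree is at most `1.203` times the total perimeter of any packing by
rectangles with the same areas. -/
theorem HTree.Huff.cost_le_packing {n : ℕ} {L M : ℝ} {A X Y W H : Fin n → ℝ}
    (hP : Packing L M A X Y W H) (hML : M ≤ L) (hM : 0 < M) (hS : ∑ i, A i = L * M) {t : HTree}
    (hH : t.Huff) (ht : t.leaves = Finset.univ.val.map A) :
    t.cost M ≤ 1.203 * ∑ i, (W i + H i) := by
  have hsum : ∀ (s : HTree) (T : Finset (Fin n)), s.leaves = T.val.map A → ∀ f : ℝ → ℝ,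
      s.leafSum f = ∑ i ∈ T, f (A i) := by
    intro s T hs f
    rw [leafSum_eq, hs, Multiset.map_map]; rfl
  have hwt : t.wt = L * M := by rw [← hS]; exact hsum t _ ht id
  refine hH.cost_le hM (by rw [hwt]; nlinarith) ?_ ?_ ?_
  · rw [lb, hsum t _ ht]
    exact Finset.sum_le_sum fun i _ => hP.minPerim_le_perim (Or.inr (hP.swap.w_le i))
  · intro a s hs _
    have hl : a ::ₘ s.leaves = Finset.univ.val.map A := by rw [← ht, hs.leaves]; rfl
    obtain ⟨j, hj, rfl, hN⟩ := exists_erase_of_map_eq_cons hl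
    have hw : t.wt = A j + s.wt := hs.wt
    have hz : s.wt / M = (L * M - A j) / M := by rw [← hwt, hw]; ring
    rw [lb, hsum s _ hN, ← Finset.add_sum_erase _ _ hj]
    refine add_le_add (hP.minPerim_le_perim (Or.inr (hP.swap.w_le j))) ?_
    refine Finset.sum_le_sum fun i hi => hP.minPerim_le_perim ?_
    rw [hz]
    exact hP.short_side hML (Finset.ne_of_mem_erase hi)
  · intro b x a s hb hs hax h2 z hz1 hz2
    have hl : x ::ₘ b.leaves = Finset.univ.val.map A := by rw [← ht, hb.symm.leaves]; rfl
    obtain ⟨k, hk, rfl, hN⟩ := exists_erase_of_map_eq_cons hl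
    have hl2 : a ::ₘ s.leaves = (Finset.univ.erase k).val.map A := by
      rw [← hN, hs.leaves]; rfl
    obtain ⟨j, hj, rfl, hN2⟩ := exists_erase_of_map_eq_cons hl2
    have hjk := Finset.ne_of_mem_erase hj
    have hw1 : t.wt = b.wt + A k := hb.wt
    have hw2 : b.wt = A j + s.wt := hs.wt
    have hs0 := ((hs.huff (hb.huff hH).1).2.1).wt_pos
    rw [← Finset.add_sum_erase _ _ hk, ← Finset.add_sum_erase _ _ hj]
    have hroot := fun i => two_sqrt_le_add_div (hP.w_pos i) (hP.area_pos i).le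
    have hperim : ∀ i, 2 * √(A i) ≤ W i + H i := by
      intro i
      have : H i = A i / W i := by
        rw [← hP.area i, mul_div_cancel_left₀ _ (hP.w_pos i).ne']
      rw [this]; exact hroot i
    rcases hP.sep j k hjk with hsep | hsep
    · left
      have e1 : s.lb z ≤ ∑ i ∈ (Finset.univ.erase k).erase j, (W i + H i) := by
        rw [lb, hsum s _ hN2]
        refine Finset.sum_le_sum fun i hi => hP.minPerim_le_perim ?_
        have hi1 := Finset.ne_of_mem_erase hi
        have hi2 := Finset.ne_of_mem_erase (Finset.mem_of_mem_erase hi)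
        rw [hw2] at hz2
        exact hP.short_side₂ hi1 hi2 hsep hax hs0.le (by linarith) hz1 hz2
      linarith [hperim j, hperim k]
    · right
      have e1 : 2 * s.sig ≤ ∑ i ∈ (Finset.univ.erase k).erase j, (W i + H i) := by
        rw [sig, hsum s _ hN2, Finset.mul_sum]
        exact Finset.sum_le_sum fun i _ => hperim i
      have e2 := hP.stacked hML (hP.swap.w_add_w_le hsep) hax (e := s.wt) (by linarith)
        (by linarith)
      linarith

/-! ### The pairs of weights merged by a greedy bundling -/

/-- The pairs of weights merged when the two smallest elements of a multiset are replaced by their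
sum, `k` times or until fewer than two elements are left. -/
def greedyPairs : ℕ → Multiset ℝ → Multiset (ℝ × ℝ)
  | 0, _ => 0
  | k + 1, s =>
    match s.sort (· ≤ ·) with
    | x :: y :: l => (x, y) ::ₘ greedyPairs k ((x + y) ::ₘ (l : Multiset ℝ))
    | _ => 0

/-- The pairs of weights merged by a Huffman bundling. -/
def huffPairs (s : Multiset ℝ) : Multiset (ℝ × ℝ) := greedyPairs s.card s

lemma huffPairs_singleton (a : ℝ) : huffPairs {a} = 0 := by
  simp [huffPairs, greedyPairs]

/-- Only values are recorded, so it does not matter which of several equal elements is merged. -/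
lemma huffPairs_cons_cons {x y : ℝ} {s : Multiset ℝ} (hxy : x ≤ y) (hs : ∀ z ∈ s, y ≤ z) :
    huffPairs (x ::ₘ y ::ₘ s) = (x, y) ::ₘ huffPairs ((x + y) ::ₘ s) := by
  have e : (x ::ₘ y ::ₘ s).sort (· ≤ ·) = x :: y :: s.sort (· ≤ ·) := by
    rw [Multiset.sort_cons, Multiset.sort_cons]
    · exact hs
    · intro z hz
      rcases Multiset.mem_cons.1 hz with rfl | hz
      · exact hxy
      · exact hxy.trans (hs z hz)
  rw [huffPairs, huffPairs, Multiset.card_cons, greedyPairs, e]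
  simp

/-- Any two members of the multiset are comparable as intervals. -/
def Chain (s : Multiset (ℝ × ℝ)) : Prop :=
  ∀ p q, p ::ₘ {q} ≤ s → p.2 ≤ q.1 ∨ q.2 ≤ p.1

lemma Chain.mono {s t : Multiset (ℝ × ℝ)} (ht : Chain t) (h : s ≤ t) : Chain s :=
  fun p q hpq => ht p q (hpq.trans h)

lemma le_greedyPairs {k : ℕ} {s : Multiset ℝ} {y : ℝ} (hy : 0 ≤ y) (hs : ∀ z ∈ s, y ≤ z) :
    ∀ p ∈ greedyPairs k s, y ≤ p.1 := by
  induction k generalizing s with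
  | zero => simp [greedyPairs]
  | succ k ih =>
    intro p hp
    rw [greedyPairs] at hp
    split at hp
    · rename_i a b l hl
      have hmem : ∀ z ∈ a :: b :: l, y ≤ z := fun z hz =>
        hs z ((Multiset.mem_sort (r := (· ≤ ·))).1 (by rw [hl]; exact hz))
      rcases Multiset.mem_cons.1 hp with rfl | hp
      · exact hmem _ (by simp)
      · refine ih (fun z hz => ?_) p hp
        rcases Multiset.mem_cons.1 hz with rfl | hz
        · have h1 := hmem a (by simp)
          have h2 := hmem b (by simp)
          linarith
        · exact hmem z (by simp [Multiset.mem_coe.1 hz])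
    · simp at hp

/-- After merging `a ≤ b`, everything left is at least `b`, and so is every entry merged later. -/
lemma chain_greedyPairs {k : ℕ} {s : Multiset ℝ} (hs : ∀ z ∈ s, 0 ≤ z) :
    Chain (greedyPairs k s) := by
  induction k generalizing s with
  | zero =>
    intro p q h
    simp [greedyPairs] at h
  | succ k ih =>
    rw [greedyPairs]
    split
    · rename_i a b l hl
      have hsort : (a :: b :: l).Pairwise (· ≤ ·) := by
        rw [← hl]; exact Multiset.pairwise_sort _ _
      have hmem : ∀ z ∈ a :: b :: l, 0 ≤ z := fun z hz =>
        hs z ((Multiset.mem_sort (r := (· ≤ ·))).1 (by rw [hl]; exact hz))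
      have ha := hmem a (by simp)
      have hb := hmem b (by simp)
      have hbl : ∀ z ∈ l, b ≤ z := (List.pairwise_cons.1 (List.pairwise_cons.1 hsort).2).1
      have hall : ∀ z ∈ (a + b) ::ₘ (l : Multiset ℝ), b ≤ z := by
        intro z hz
        rcases Multiset.mem_cons.1 hz with rfl | hz
        · linarith
        · exact hbl z (Multiset.mem_coe.1 hz)
      have hch := ih (s := (a + b) ::ₘ (l : Multiset ℝ)) fun z hz => hb.trans (hall z hz)
      have hle := le_greedyPairs (k := k) hb hall
      intro p q hpq
      by_cases hp : p = (a, b)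
      · subst hp
        left
        rw [Multiset.cons_le_cons_iff, Multiset.singleton_le] at hpq
        exact hle q hpq
      by_cases hq : q = (a, b)
      · subst hq
        right
        rw [← Multiset.cons_zero, Multiset.cons_swap, Multiset.cons_le_cons_iff,
          Multiset.cons_zero, Multiset.singleton_le] at hpq
        exact hle p hpq
      · refine hch p q ((Multiset.le_cons_of_notMem ?_).1 hpq)
        simp [Ne.symm hp, Ne.symm hq]
    · intro p q h
      simp at h

namespace HTree

lemma pairs_bounds {t : HTree} (ht : ∀ a ∈ t.leaves, 0 < a) :
    0 < t.wt ∧ ∀ p ∈ t.pairs, 0 < p.2 ∧ p.1 + p.2 ≤ t.wt := by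
  induction t with
  | leaf a => exact ⟨ht a (by simp [leaves]), by simp [pairs]⟩
  | node l r hl hr =>
    obtain ⟨l1, l2⟩ := hl fun a ha => ht a (by simp [leaves, ha])
    obtain ⟨r1, r2⟩ := hr fun a ha => ht a (by simp [leaves, ha])
    rw [wt_node]
    refine ⟨by linarith, fun p hp => ?_⟩
    rw [pairs, Multiset.mem_cons, Multiset.mem_add] at hp
    rcases hp with rfl | hp | hp
    · exact ⟨lt_max_of_lt_left l1, by simp [min_add_max]⟩
    · exact ⟨(l2 p hp).1, by linarith [(l2 p hp).2]⟩
    · exact ⟨(r2 p hp).1, by linarith [(r2 p hp).2]⟩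

/-- A pair inside a child cannot lie above the root pair, because its positive entries add up to at
most the weight of that child. So it lies below. -/
lemma huff_of_chain {t : HTree} (ht : ∀ a ∈ t.leaves, 0 < a) (hc : Chain t.pairs) : t.Huff := by
  induction t with
  | leaf a => exact ht a (by simp [leaves])
  | node l r hl hr =>
    have htl : ∀ a ∈ l.leaves, 0 < a := fun a ha => ht a (by simp [leaves, ha])
    have htr : ∀ a ∈ r.leaves, 0 < a := fun a ha => ht a (by simp [leaves, ha])
    have hle : l.pairs + r.pairs ≤ (node l r).pairs := Multiset.le_cons_self _ _
    refine ⟨hl htl (hc.mono ((Multiset.le_add_right _ _).trans hle)),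
      hr htr (hc.mono ((Multiset.le_add_left _ _).trans hle)), fun p hp q hq => ?_,
      fun p hp => ?_⟩
    · refine hc p q (le_trans ?_ hle)
      exact add_le_add (Multiset.singleton_le.2 hp) (Multiset.singleton_le.2 hq)
    · have h1 := hc (min l.wt r.wt, max l.wt r.wt) p
        (Multiset.cons_le_cons _ (Multiset.singleton_le.2 hp))
      rcases h1 with h1 | h1
      · exfalso
        simp only [max_le_iff] at h1
        rcases Multiset.mem_add.1 hp with hp | hp
        · have := (pairs_bounds htl).2 p hp
          linarith
        · have := (pairs_bounds htr).2 p hp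
          linarith
      · exact h1

end HTree

/-! ### The bundling phase -/

section Bundling

variable {n : ℕ} {A : Fin n → ℝ}

/-- The multiset of the areas in a block. -/
def areas (A : Fin n → ℝ) (B : List (Fin n)) : Multiset ℝ := (B.map A : List ℝ)

lemma areas_append (B C : List (Fin n)) : areas A (B ++ C) = areas A B + areas A C := by
  simp [areas]

lemma blockArea_append (B C : List (Fin n)) :
    blockArea A (B ++ C) = blockArea A B + blockArea A C := by
  simp [blockArea]

lemma blockArea_eq_of_perm {B C : List (Fin n)} (h : B.Perm C) :
    blockArea A B = blockArea A C := (h.map A).sum_eq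

lemma blockArea_pos (hA : ∀ i, 0 < A i) {B : List (Fin n)} (hB : B ≠ []) :
    0 < blockArea A B := by
  refine List.sum_pos _ (fun x hx => ?_) (by simpa using hB)
  obtain ⟨i, -, rfl⟩ := List.mem_map.1 hx
  exact hA i

/-- The pairs merged inside the blocks of any selection, and those merged when the selected blocks
are bundled further, are the pairs merged in a bundling of all labels of the selection. -/
def Coherent (A : Fin n → ℝ) (L : List (List (Fin n))) : Prop :=
  ∀ G : Multiset (List (Fin n)), G ≤ L → huffPairs (G.map (areas A)).sum =
    (G.map fun B => huffPairs (areas A B)).sum + huffPairs (G.map (blockArea A))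

/-- In a selection containing the merged block, replace that block by `B` and `C`. These are the
smallest blocks, so the old invariant applies and the bundling of the block areas begins by merging
them. Any other selection was already available before. -/
lemma BundleStep.coherent {L L' : List (List (Fin n))}
    (h : BundleStep A L L') (hs : BlocksSorted A L) (hc : Coherent A L) : Coherent A L' := by
  obtain ⟨L₁, L₂, B, C, hs'⟩ := h
  have hLe : ((L₁ ++ L₂ ++ [B, C] : List (List (Fin n))) : Multiset (List (Fin n)))
      = C ::ₘ B ::ₘ ((L₁ ++ L₂ : List (List (Fin n))) : Multiset (List (Fin n))) := by
    rw [← Multiset.coe_add]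
    have : (([B, C] : List (List (Fin n))) : Multiset (List (Fin n))) = C ::ₘ B ::ₘ 0 := by
      rw [Multiset.cons_swap]; rfl
    rw [this, Multiset.add_cons, Multiset.add_cons, add_zero]
  have hLe' : ((L₁ ++ (B ++ C) :: L₂ : List (List (Fin n))) : Multiset (List (Fin n)))
      = (B ++ C) ::ₘ ((L₁ ++ L₂ : List (List (Fin n))) : Multiset (List (Fin n))) := by
    rw [← Multiset.coe_add, ← Multiset.cons_coe, Multiset.add_cons, Multiset.coe_add]
  rw [BlocksSorted, List.pairwise_append] at hs
  obtain ⟨-, hBC, hrest⟩ := hs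
  have hCB : blockArea A C ≤ blockArea A B := by simpa using hBC
  have hsmall : ∀ D ∈ ((L₁ ++ L₂ : List (List (Fin n))) : Multiset (List (Fin n))),
      blockArea A B ≤ blockArea A D := fun D hD => hrest D (Multiset.mem_coe.1 hD) B (by simp)
  have step : ∀ G : Multiset (List (Fin n)),
      G ≤ ((L₁ ++ L₂ : List (List (Fin n))) : Multiset (List (Fin n))) →
      huffPairs ((C ::ₘ B ::ₘ G).map (areas A)).sum =
        huffPairs (areas A C) + huffPairs (areas A B) +
        (G.map fun B => huffPairs (areas A B)).sum +
        ((blockArea A C, blockArea A B) ::ₘ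
          huffPairs ((blockArea A C + blockArea A B) ::ₘ G.map (blockArea A))) := by
    intro G hG
    rw [hc (C ::ₘ B ::ₘ G) (by
      rw [hLe]; exact Multiset.cons_le_cons _ (Multiset.cons_le_cons _ hG))]
    simp only [Multiset.map_cons, Multiset.sum_cons]
    rw [huffPairs_cons_cons hCB]
    · simp only [add_assoc]
    · intro z hz
      obtain ⟨D, hD, rfl⟩ := Multiset.mem_map.1 hz
      exact hsmall D (Multiset.mem_of_le hG hD)
  -- The selection of `B` and `C` alone describes the inside of the merged block.
  have hmerge : huffPairs (areas A (B ++ C)) = huffPairs (areas A C) + huffPairs (areas A B) +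
      {(blockArea A C, blockArea A B)} := by
    have := step 0 (Multiset.zero_le _)
    simp only [Multiset.map_cons, Multiset.sum_cons, Multiset.map_zero, Multiset.sum_zero,
      add_zero, Multiset.cons_zero, Multiset.map_singleton, Multiset.sum_singleton,
      huffPairs_singleton] at this
    rw [areas_append, add_comm (areas A B), this]
  intro G hG
  rw [hLe'] at hG
  by_cases hmem : (B ++ C) ∈ G
  · obtain ⟨G₀, rfl⟩ := Multiset.exists_cons_of_mem hmem
    rw [Multiset.cons_le_cons_iff] at hG
    have h1 := step G₀ hG
    simp only [Multiset.map_cons, Multiset.sum_cons] at h1 ⊢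
    rw [areas_append, add_comm (areas A B), add_assoc, h1, add_comm (areas A C), ← areas_append,
      hmerge, blockArea_append, add_comm (blockArea A B), ← Multiset.singleton_add]
    abel
  · refine hc G (((Multiset.le_cons_of_notMem hmem).1 hG).trans ?_)
    rw [hLe]
    exact (Multiset.le_cons_self _ _).trans (Multiset.le_cons_self _ _)

lemma coherent_singletons (S : List (Fin n)) : Coherent A (S.map fun i => [i]) := by
  intro G hG
  have key : ∀ G : Multiset (List (Fin n)), (∀ B ∈ G, ∃ i, B = [i]) →
      (G.map fun B => huffPairs (areas A B)).sum = 0 ∧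
        (G.map (areas A)).sum = G.map (blockArea A) := by
    intro G
    induction G using Multiset.induction_on with
    | empty => intro _; simp
    | cons B G ih =>
      intro hB
      obtain ⟨i, rfl⟩ := hB B (Multiset.mem_cons_self _ _)
      obtain ⟨h1, h2⟩ := ih fun B hB' => hB B (Multiset.mem_cons_of_mem hB')
      have h3 : areas A [i] = {A i} := rfl
      refine ⟨?_, ?_⟩
      · rw [Multiset.map_cons, Multiset.sum_cons, h1, h3, huffPairs_singleton, zero_add]
      · rw [Multiset.map_cons, Multiset.sum_cons, h2, h3, Multiset.map_cons,
          Multiset.singleton_add]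
        simp [blockArea]
  obtain ⟨h1, h2⟩ := key G fun B hB => by
    have := Multiset.mem_of_le hG hB
    rw [Multiset.mem_coe, List.mem_map] at this
    obtain ⟨i, -, rfl⟩ := this
    exact ⟨i, rfl⟩
  rw [h1, h2, zero_add]

/-- What the bundling loop preserves. -/
structure BundleInv (A : Fin n → ℝ) (Λ : List (Fin n)) (L : List (List (Fin n))) : Prop where
  sorted : BlocksSorted A L
  coherent : Coherent A L
  perm : L.flatten.Perm Λ
  ne_nil : ∀ B ∈ L, B ≠ []

lemma BundleInv.init {Λ S : List (Fin n)} (hS : S.Perm Λ)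
    (hs : S.Pairwise (fun i j => A j ≤ A i)) : BundleInv A Λ (S.map fun i => [i]) := by
  refine ⟨?_, coherent_singletons S, ?_, ?_⟩
  · rw [BlocksSorted, List.pairwise_map]
    simpa [blockArea] using hs
  · have : ∀ T : List (Fin n), (T.map fun i => [i]).flatten = T := fun T => by
      induction T with
      | nil => rfl
      | cons a T ih => simpa using ih
    rwa [this]
  · intro B hB
    obtain ⟨i, -, rfl⟩ := List.mem_map.1 hB
    simp

lemma BundleInv.step {Λ : List (Fin n)} {L L' : List (List (Fin n))}
    (hL : BundleInv A Λ L) (h : BundleStep A L L') : BundleInv A Λ L' := by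
  have hc := h.coherent hL.sorted hL.coherent
  obtain ⟨L₁, L₂, B, C, hs'⟩ := h
  refine ⟨hs', hc, ?_, ?_⟩
  · refine List.Perm.trans ?_ hL.perm
    simp only [List.flatten_append, List.flatten_cons, List.flatten_nil, List.append_nil,
      List.append_assoc]
    refine List.Perm.append_left _ ?_
    rw [← List.append_assoc]
    exact List.perm_append_comm
  · intro D hD
    simp only [List.mem_append, List.mem_cons] at hD
    rcases hD with hD | rfl | hD
    · exact hL.ne_nil D (by simp [hD])
    · have := hL.ne_nil B (by simp)
      simp [this]
    · exact hL.ne_nil D (by simp [hD])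

lemma BundlesTo.inv {Λ B₁ B₂ : List (Fin n)} (h : BundlesTo A Λ B₁ B₂) :
    BundleInv A Λ [B₁, B₂] := by
  obtain ⟨S, hS, hs, hr⟩ := h
  generalize [B₁, B₂] = L at hr ⊢
  induction hr with
  | refl => exact .init hS hs
  | tail _ h ih => exact ih.step h

/-- The two blocks in which the bundling phase ends. -/
lemma BundlesTo.spec {Λ B₁ B₂ : List (Fin n)} (h : BundlesTo A Λ B₁ B₂) :
    (B₁ ++ B₂).Perm Λ ∧ B₁ ≠ [] ∧ B₂ ≠ [] ∧ blockArea A B₂ ≤ blockArea A B₁ ∧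
      huffPairs (areas A Λ) = (blockArea A B₂, blockArea A B₁) ::ₘ
        (huffPairs (areas A B₁) + huffPairs (areas A B₂)) := by
  obtain ⟨hs, hc, hp, hn⟩ := h.inv
  have hle : blockArea A B₂ ≤ blockArea A B₁ := by simpa [BlocksSorted] using hs
  have hp' : (B₁ ++ B₂).Perm Λ := by simpa using hp
  refine ⟨hp', hn _ (by simp), hn _ (by simp), hle, ?_⟩
  have h1 := hc (B₂ ::ₘ B₁ ::ₘ 0) (by rw [Multiset.cons_swap]; exact le_rfl)
  simp only [Multiset.map_cons, Multiset.sum_cons, Multiset.map_zero, Multiset.sum_zero,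
    add_zero] at h1
  have e : areas A Λ = areas A B₂ + areas A B₁ := by
    rw [add_comm, ← areas_append]
    exact (Multiset.coe_eq_coe.2 (hp'.map A)).symm
  rw [e, h1, huffPairs_cons_cons hle (by simp), Multiset.cons_zero, huffPairs_singleton,
    Multiset.cons_zero, ← Multiset.singleton_add, add_comm, add_comm (huffPairs (areas A B₂))]

lemma exists_insert_sorted (X : List (Fin n)) {L : List (List (Fin n))}
    (hL : BlocksSorted A L) : ∃ L₁ L₂, L = L₁ ++ L₂ ∧ BlocksSorted A (L₁ ++ X :: L₂) := by
  induction L with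
  | nil => exact ⟨[], [], rfl, List.pairwise_singleton _ _⟩
  | cons D L ih =>
    obtain ⟨h1, h2⟩ := List.pairwise_cons.1 hL
    rcases le_total (blockArea A D) (blockArea A X) with h | h
    · refine ⟨[], D :: L, rfl, List.pairwise_cons.2 ⟨fun C hC => ?_, hL⟩⟩
      rcases List.mem_cons.1 hC with rfl | hC
      · exact h
      · exact (h1 C hC).trans h
    · obtain ⟨L₁, L₂, rfl, h3⟩ := ih h2
      refine ⟨D :: L₁, L₂, rfl, List.pairwise_cons.2 ⟨fun C hC => ?_, h3⟩⟩
      replace hC : C ∈ L₁ ++ X :: L₂ := hC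
      simp only [List.mem_append, List.mem_cons] at hC
      rcases hC with hC | rfl | hC
      · exact h1 C (by simp [hC])
      · exact h
      · exact h1 C (by simp [hC])

lemma exists_reflTransGen_bundleStep (k : ℕ) {L : List (List (Fin n))} (hk : L.length = k + 2)
    (hL : BlocksSorted A L) : ∃ B₁ B₂, Relation.ReflTransGen (BundleStep A) L [B₁, B₂] := by
  induction k generalizing L with
  | zero =>
    obtain ⟨B₁, B₂, rfl⟩ := List.length_eq_two.1 hk
    exact ⟨B₁, B₂, .refl⟩
  | succ k ih =>
    obtain ⟨L', C, rfl⟩ := (List.eq_nil_or_concat L).resolve_left (by rintro rfl; simp at hk)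
    obtain ⟨L₀, B, rfl⟩ := (List.eq_nil_or_concat L').resolve_left
      (by rintro rfl; simp at hk)
    have e : L₀ ++ [B] ++ [C] = L₀ ++ [B, C] := by simp
    rw [List.concat_eq_append, List.concat_eq_append, e] at hk hL ⊢
    obtain ⟨L₁, L₂, rfl, hs⟩ := exists_insert_sorted (B ++ C) (List.pairwise_append.1 hL).1
    obtain ⟨B₁, B₂, hr⟩ := ih (by simp at hk ⊢; omega) hs
    exact ⟨B₁, B₂, .head (.merge L₁ L₂ B C hs) hr⟩

lemma exists_bundlesTo {Λ : List (Fin n)} (hΛ : 2 ≤ Λ.length) :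
    ∃ B₁ B₂, BundlesTo A Λ B₁ B₂ := by
  have hs := List.pairwise_mergeSort (le := fun i j => decide (A j ≤ A i))
    (fun a b c h1 h2 => by simp at h1 h2 ⊢; exact h2.trans h1)
    (fun a b => by simpa using le_total _ _) Λ
  have hp := List.mergeSort_perm Λ (fun i j => decide (A j ≤ A i))
  set S := Λ.mergeSort (fun i j => decide (A j ≤ A i))
  have hs' : S.Pairwise (fun i j => A j ≤ A i) := by simpa using hs
  obtain ⟨B₁, B₂, hr⟩ := exists_reflTransGen_bundleStep (A := A) (L := S.map fun i => [i])
    (Λ.length - 2) (by rw [List.length_map, hp.length_eq]; omega)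
    (by rw [BlocksSorted, List.pairwise_map]; simpa [blockArea] using hs')
  exact ⟨B₁, B₂, S, hp, hs', hr⟩

end Bundling

/-! ### Runs of the algorithm -/

/-- `Q` is cut into `Q₁` and `Q₂`, of areas `a₁` and `a₂`, parallel to a shorter side. -/
structure IsCut (Q Q₁ Q₂ : Rect) (a₁ a₂ : ℝ) : Prop where
  nondegenerate₁ : Q₁.Nondegenerate
  nondegenerate₂ : Q₂.Nondegenerate
  area₁ : Q₁.area = a₁
  area₂ : Q₂.area = a₂
  union : Q₁.toSet ∪ Q₂.toSet = Q.toSet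
  disjoint : Disjoint (interior Q₁.toSet) (interior Q₂.toSet)
  side : (Q.h ^ 2 ≤ Q.area ∧ Q₁.h = Q.h ∧ Q₂.h = Q.h) ∨
    (Q.w ^ 2 ≤ Q.area ∧ Q₁.w = Q.w ∧ Q₂.w = Q.w)

lemma isCut_vertical {Q : Rect} (hQ : Q.Nondegenerate) (h : Q.h < Q.w) {a₁ a₂ : ℝ} (h₁ : 0 < a₁)
    (h₂ : 0 < a₂) (ha : a₁ + a₂ = Q.area) : IsCut Q (Q.left a₁) (Q.right a₁) a₁ a₂ := by
  obtain ⟨hw, hh⟩ := hQ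
  have hc : 0 < a₁ / Q.h := div_pos h₁ hh
  have e₁ : a₁ / Q.h * Q.h = a₁ := div_mul_cancel₀ _ hh.ne'
  have e₂ : (Q.w - a₁ / Q.h) * Q.h = a₂ := by
    rw [sub_mul, e₁]; simp only [Rect.area] at ha; linarith
  have hc' : 0 < Q.w - a₁ / Q.h := by
    refine pos_of_mul_pos_left ?_ hh.le
    rw [e₂]; exact h₂
  refine ⟨⟨hc, hh⟩, ⟨hc', hh⟩, e₁, e₂, ?_, ?_, .inl ⟨?_, rfl, rfl⟩⟩
  · simp only [Rect.toSet, Rect.left, Rect.right]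
    rw [← Set.union_prod, Set.Icc_union_Icc_eq_Icc (by linarith) (by linarith)]
    congr 2; ring
  · rw [Rect.interior_toSet, Rect.interior_toSet]
    refine Set.Disjoint.set_prod_left ?_ _ _
    rw [Set.disjoint_left]
    rintro x ⟨-, h3⟩ ⟨h4, -⟩
    exact lt_asymm h3 h4
  · simp only [Rect.area]; nlinarith

lemma isCut_horizontal {Q : Rect} (hQ : Q.Nondegenerate) (h : Q.w ≤ Q.h) {a₁ a₂ : ℝ} (h₁ : 0 < a₁)
    (h₂ : 0 < a₂) (ha : a₁ + a₂ = Q.area) : IsCut Q (Q.top a₁) (Q.bottom a₁) a₁ a₂ := by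
  obtain ⟨hw, hh⟩ := hQ
  have hc : 0 < a₁ / Q.w := div_pos h₁ hw
  have e₁ : Q.w * (a₁ / Q.w) = a₁ := mul_div_cancel₀ _ hw.ne'
  have e₂ : Q.w * (Q.h - a₁ / Q.w) = a₂ := by
    rw [mul_sub, e₁]; simp only [Rect.area] at ha; linarith
  have hc' : 0 < Q.h - a₁ / Q.w := by
    refine pos_of_mul_pos_right ?_ hw.le
    rw [e₂]; exact h₂
  refine ⟨⟨hw, hc⟩, ⟨hw, hc'⟩, e₁, e₂, ?_, ?_, .inr ⟨?_, rfl, rfl⟩⟩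
  · simp only [Rect.toSet, Rect.top, Rect.bottom]
    rw [← Set.prod_union, Set.union_comm, Set.Icc_union_Icc_eq_Icc (by linarith) (by linarith)]
    congr 2; ring
  · rw [Rect.interior_toSet, Rect.interior_toSet]
    refine Set.Disjoint.set_prod_right ?_ _ _
    rw [Set.disjoint_left]
    rintro x ⟨h3, -⟩ ⟨-, h4⟩
    exact lt_asymm h3 h4
  · simp only [Rect.area]; nlinarith

section Runs

variable {n : ℕ} {A : Fin n → ℝ} {P : Fin n → Rect}

lemma BundlesTo.blockArea_add {Λ B₁ B₂ : List (Fin n)}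
    (h : BundlesTo A Λ B₁ B₂) : blockArea A B₁ + blockArea A B₂ = blockArea A Λ := by
  rw [← blockArea_append]
  exact blockArea_eq_of_perm (h.spec).1

/-- Induction over a run of the algorithm on positive areas. -/
lemma Run.induction_cut (hA : ∀ i, 0 < A i) {motive : Rect → List (Fin n) → Prop}
    (single : ∀ i, (P i).Nondegenerate → (P i).area = A i → motive (P i) [i])
    (cut : ∀ Q Q₁ Q₂ Λ B₁ B₂, Q.Nondegenerate → blockArea A Λ = Q.area → BundlesTo A Λ B₁ B₂ →
      IsCut Q Q₁ Q₂ (blockArea A B₁) (blockArea A B₂) → motive Q₁ B₁ → motive Q₂ B₂ → motive Q Λ)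
    {Q : Rect} {Λ : List (Fin n)} (h : Run A P Q Λ) (hQ : Q.Nondegenerate)
    (hΛ : blockArea A Λ = Q.area) : motive Q Λ := by
  induction h with
  | single Q i h =>
    subst h
    exact single i hQ (by simpa [blockArea] using hΛ.symm)
  | vertical Q Λ B₁ B₂ _ hB hwh _ _ ih₁ ih₂ =>
    obtain ⟨-, hn₁, hn₂, -⟩ := hB.spec
    have hc := isCut_vertical hQ hwh (blockArea_pos hA hn₁) (blockArea_pos hA hn₂)
      ((hB.blockArea_add).trans hΛ)
    exact cut Q _ _ Λ B₁ B₂ hQ hΛ hB hc (ih₁ hc.nondegenerate₁ hc.area₁.symm)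
      (ih₂ hc.nondegenerate₂ hc.area₂.symm)
  | horizontal Q Λ B₁ B₂ _ hB hwh _ _ ih₁ ih₂ =>
    obtain ⟨-, hn₁, hn₂, -⟩ := hB.spec
    have hc := isCut_horizontal hQ hwh (blockArea_pos hA hn₁) (blockArea_pos hA hn₂)
      ((hB.blockArea_add).trans hΛ)
    exact cut Q _ _ Λ B₁ B₂ hQ hΛ hB hc (ih₁ hc.nondegenerate₁ hc.area₁.symm)
      (ih₂ hc.nondegenerate₂ hc.area₂.symm)

/-- A run of the algorithm follows a Huffman tree. -/
lemma Run.exists_tree (hA : ∀ i, 0 < A i) {Q : Rect} {Λ : List (Fin n)} (h : Run A P Q Λ)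
    (hQ : Q.Nondegenerate) (hΛ : blockArea A Λ = Q.area) :
    ∃ t : HTree, t.leaves = areas A Λ ∧ t.Huff ∧ t.wt = Q.area ∧
      (Λ.map fun i => (P i).perim).sum = t.cost Q.h := by
  -- The equality of pairs is additive over cuts by `BundlesTo.spec`, whereas the sibling property
  -- compares different subtrees; it is deduced at the end.
  suffices H : ∃ t : HTree, t.leaves = areas A Λ ∧
      t.pairs = huffPairs (areas A Λ) ∧ t.wt = Q.area ∧
      (Λ.map fun i => (P i).perim).sum = t.cost Q.h by
    obtain ⟨t, h1, h2, h3, h4⟩ := H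
    have hpos : ∀ a ∈ areas A Λ, 0 < a := by
      intro a ha
      obtain ⟨i, -, rfl⟩ := List.mem_map.1 (Multiset.mem_coe.1 ha)
      exact hA i
    refine ⟨t, h1, HTree.huff_of_chain (by rwa [h1]) ?_, h3, h4⟩
    rw [h2]
    exact chain_greedyPairs fun a ha => (hpos a ha).le
  refine Run.induction_cut hA (motive := fun Q Λ => ∃ t : HTree, t.leaves = areas A Λ ∧
    t.pairs = huffPairs (areas A Λ) ∧ t.wt = Q.area ∧
    (Λ.map fun i => (P i).perim).sum = t.cost Q.h) ?_ ?_ h hQ hΛ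
  · intro i hn ha
    refine ⟨.leaf (A i), rfl, ?_, ha.symm, ?_⟩
    · exact (huffPairs_singleton (A i)).symm
    · rw [HTree.cost_leaf, ← ha, Rect.area, mul_div_cancel_right₀ _ hn.2.ne']
      simp [Rect.perim, add_comm]
  · rintro Q Q₁ Q₂ Λ B₁ B₂ hn hΛ hB hc ⟨t₁, l₁, p₁, w₁, c₁⟩ ⟨t₂, l₂, p₂, w₂, c₂⟩
    obtain ⟨hp, -, -, hle, hh⟩ := hB.spec
    have hadd : Q₁.area + Q₂.area = Q.area := by
      rw [hc.area₁, hc.area₂, hB.blockArea_add, hΛ]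
    have hs : (HTree.node t₁ t₂).Splits t₁ t₂ := .inl rfl
    have hw : (HTree.node t₁ t₂).wt = Q.area := by rw [HTree.wt_node, w₁, w₂, hadd]
    refine ⟨.node t₁ t₂, ?_, ?_, hw, ?_⟩
    · rw [HTree.leaves, l₁, l₂, ← areas_append]
      exact Multiset.coe_eq_coe.2 (hp.map A)
    · rw [HTree.pairs, w₁, w₂, hc.area₁, hc.area₂, min_eq_right hle, max_eq_left hle, hh, p₁, p₂]
    · rw [← (hp.map _).sum_eq, List.map_append, List.sum_append, c₁, c₂]
      have hwh : Q.area / Q.w = Q.h := mul_div_cancel_left₀ _ hn.1.ne'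
      have swap : ∀ (t : HTree) (S : Rect), S.Nondegenerate → t.wt = S.area →
          t.cost S.h = t.cost S.w := by
        intro t S hS ht
        have hwt : 0 < t.wt := by rw [ht]; exact mul_pos hS.1 hS.2
        rw [← HTree.cost_swap hwt hS.1, ht, Rect.area, mul_div_cancel_left₀ _ hS.1.ne']
      rcases hc.side with ⟨h1, h2, h3⟩ | ⟨h1, h2, h3⟩
      · rw [h2, h3, hs.cost hn.2 (h1.trans_eq hw.symm)]
      · rw [swap t₁ _ hc.nondegenerate₁ w₁, swap t₂ _ hc.nondegenerate₂ w₂, swap _ Q hn hw, h2, h3,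
          hs.cost hn.1 (h1.trans_eq hw.symm)]

/-- The rectangles produced by a run form a dissection. -/
lemma Run.dissection (hA : ∀ i, 0 < A i) {Q : Rect} {Λ : List (Fin n)} (h : Run A P Q Λ)
    (hQ : Q.Nondegenerate) (hΛ : blockArea A Λ = Q.area) :
    (∀ i ∈ Λ, (P i).Nondegenerate ∧ (P i).area = A i) ∧ ⋃ i ∈ Λ, (P i).toSet = Q.toSet ∧
      (Λ.Nodup → ∀ i ∈ Λ, ∀ j ∈ Λ, i ≠ j →
        Disjoint (interior (P i).toSet) (interior (P j).toSet)) := by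
  refine Run.induction_cut hA (motive := fun Q Λ =>
    (∀ i ∈ Λ, (P i).Nondegenerate ∧ (P i).area = A i) ∧ ⋃ i ∈ Λ, (P i).toSet = Q.toSet ∧
      (Λ.Nodup → ∀ i ∈ Λ, ∀ j ∈ Λ, i ≠ j →
        Disjoint (interior (P i).toSet) (interior (P j).toSet))) ?_ ?_ h hQ hΛ
  · intro i hn ha
    refine ⟨by simpa using ⟨hn, ha⟩, by simp, fun _ j hj k hk hjk => ?_⟩
    simp only [List.mem_singleton] at hj hk
    exact absurd (hj.trans hk.symm) hjk
  · rintro Q Q₁ Q₂ Λ B₁ B₂ - - hB hc ⟨n₁, u₁, d₁⟩ ⟨n₂, u₂, d₂⟩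
    obtain ⟨hp, -⟩ := hB.spec
    have hmem : ∀ i, i ∈ Λ ↔ i ∈ B₁ ∨ i ∈ B₂ := fun i => by rw [← hp.mem_iff, List.mem_append]
    have s₁ : ∀ i ∈ B₁, interior (P i).toSet ⊆ interior Q₁.toSet := fun i hi =>
      interior_mono (u₁ ▸ Set.subset_biUnion_of_mem (u := fun i => (P i).toSet) hi)
    have s₂ : ∀ i ∈ B₂, interior (P i).toSet ⊆ interior Q₂.toSet := fun i hi =>
      interior_mono (u₂ ▸ Set.subset_biUnion_of_mem (u := fun i => (P i).toSet) hi)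
    refine ⟨fun i hi => ((hmem i).1 hi).elim (n₁ i) (n₂ i), ?_, fun hΛ i hi j hj hij => ?_⟩
    · rw [← hc.union, ← u₁, ← u₂]
      simp only [hmem, Set.iUnion_or, Set.iUnion_union_distrib]
    · rw [← hp.nodup_iff, List.nodup_append] at hΛ
      rcases (hmem i).1 hi with hi | hi <;> rcases (hmem j).1 hj with hj | hj
      · exact d₁ hΛ.1 i hi j hj hij
      · exact hc.disjoint.mono (s₁ i hi) (s₂ j hj)
      · exact (hc.disjoint.mono (s₁ j hj) (s₂ i hi)).symm
      · exact d₂ hΛ.2.1 i hi j hj hij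

/-- Allows runs on disjoint blocks to be glued into one assignment. -/
lemma Run.congr {P P' : Fin n → Rect} {Q : Rect} {Λ : List (Fin n)}
    (h : Run A P Q Λ) (hP : ∀ i ∈ Λ, P i = P' i) : Run A P' Q Λ := by
  induction h with
  | single Q i h => exact .single Q i ((hP i (by simp)).symm.trans h)
  | vertical Q Λ B₁ B₂ hΛ hB hwh _ _ ih₁ ih₂ =>
    have hp := (hB.spec).1
    exact .vertical Q Λ B₁ B₂ hΛ hB hwh
      (ih₁ fun i hi => hP i (hp.mem_iff.1 (List.mem_append_left _ hi)))
      (ih₂ fun i hi => hP i (hp.mem_iff.1 (List.mem_append_right _ hi)))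
  | horizontal Q Λ B₁ B₂ hΛ hB hwh _ _ ih₁ ih₂ =>
    have hp := (hB.spec).1
    exact .horizontal Q Λ B₁ B₂ hΛ hB hwh
      (ih₁ fun i hi => hP i (hp.mem_iff.1 (List.mem_append_left _ hi)))
      (ih₂ fun i hi => hP i (hp.mem_iff.1 (List.mem_append_right _ hi)))

lemma exists_run (A : Fin n → ℝ) (k : ℕ) {Λ : List (Fin n)} (hk : Λ.length = k + 1)
    (hΛ : Λ.Nodup) (Q : Rect) : ∃ P, Run A P Q Λ := by
  induction k using Nat.strong_induction_on generalizing Λ Q with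
  | h k ih =>
  rcases k.eq_zero_or_pos with rfl | hk0
  · obtain ⟨i, rfl⟩ := List.length_eq_one_iff.1 hk
    exact ⟨fun _ => Q, .single Q i rfl⟩
  have h2 : 2 ≤ Λ.length := by omega
  obtain ⟨B₁, B₂, hB⟩ := exists_bundlesTo (A := A) h2
  obtain ⟨hp, hn₁, hn₂, -⟩ := hB.spec
  have hlen : B₁.length + B₂.length = k + 1 := by rw [← List.length_append, hp.length_eq, hk]
  have hl₁ := List.length_pos_of_ne_nil hn₁
  have hl₂ := List.length_pos_of_ne_nil hn₂
  rw [← hp.nodup_iff, List.nodup_append] at hΛ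
  obtain ⟨hd₁, hd₂, hd⟩ := hΛ
  have key : ∀ Q₁ Q₂, ∃ P, Run A P Q₁ B₁ ∧ Run A P Q₂ B₂ := by
    intro Q₁ Q₂
    obtain ⟨P₁, h₁⟩ := ih (B₁.length - 1) (by omega) (by omega) hd₁ Q₁
    obtain ⟨P₂, h₂⟩ := ih (B₂.length - 1) (by omega) (by omega) hd₂ Q₂
    refine ⟨fun i => if i ∈ B₁ then P₁ i else P₂ i, h₁.congr fun i hi => (if_pos hi).symm,
      h₂.congr fun i hi => (if_neg fun hi' => hd i hi' i hi rfl).symm⟩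
  rcases lt_or_ge Q.h Q.w with hwh | hwh
  · obtain ⟨P, h₁, h₂⟩ := key (Q.left (blockArea A B₁)) (Q.right (blockArea A B₁))
    exact ⟨P, .vertical Q Λ B₁ B₂ h2 hB hwh h₁ h₂⟩
  · obtain ⟨P, h₁, h₂⟩ := key (Q.top (blockArea A B₁)) (Q.bottom (blockArea A B₁))
    exact ⟨P, .horizontal Q Λ B₁ B₂ h2 hB hwh h₁ h₂⟩

end Runs

end RectPartition

end

theorem mainTheorem1 (n : ℕ) (R : RectPartition.Rect) (hR : R.Nondegenerate)
    (A : Fin n → ℝ) (hA : ∀ i, 0 < A i) (hsum : ∑ i, A i = R.area) :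
    (∃ P : Fin n → RectPartition.Rect, RectPartition.ApproximationDC R A P) ∧
    ∀ P : Fin n → RectPartition.Rect, RectPartition.ApproximationDC R A P →
      RectPartition.IsPartition R A P ∧
      ∀ P' : Fin n → RectPartition.Rect, RectPartition.IsPartition R A P' →
        RectPartition.totalPerim P ≤ 1.203 * RectPartition.totalPerim P' := by
  have harea : 0 < R.area := mul_pos hR.1 hR.2
  have hblock : RectPartition.blockArea A (List.finRange n) = R.area := by
    rw [← hsum, Fin.sum_univ_def]; rfl
  constructor
  · have hn : n ≠ 0 := by
      rintro rfl
      simp at hsum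
      exact harea.ne hsum
    exact RectPartition.exists_run A (n - 1) (by rw [List.length_finRange]; omega)
      (List.nodup_finRange n) R
  · intro P hP
    obtain ⟨h1, h2, h3⟩ := RectPartition.Run.dissection hA hP hR hblock
    refine ⟨⟨fun i => (h1 i (List.mem_finRange i)).1, fun i j => h3 (List.nodup_finRange n) i
      (List.mem_finRange i) j (List.mem_finRange j), by simpa using h2,
      fun i => (h1 i (List.mem_finRange i)).2⟩, fun P' hP' => ?_⟩
    obtain ⟨t, hl, hH, hw, hc⟩ := RectPartition.Run.exists_tree hA hP hR hblock
    have hl' : t.leaves = Finset.univ.val.map A := by rw [hl]; rfl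
    have hc' : RectPartition.totalPerim P = t.cost R.h := by
      rw [← hc, RectPartition.totalPerim, Fin.sum_univ_def]
    rw [hc']
    rcases le_total R.h R.w with hwh | hwh
    · exact RectPartition.HTree.Huff.cost_le_packing hP'.packing hwh hR.2 hsum hH hl'
    · have hwt : 0 < t.wt := by rw [hw]; exact harea
      -- If `R` is taller than wide, the coordinates are exchanged in both the cost and the packing.
      rw [show R.h = t.wt / R.w by
        rw [hw, RectPartition.Rect.area, mul_div_cancel_left₀ _ hR.1.ne'],
        RectPartition.HTree.cost_swap hwt hR.1]
      refine (RectPartition.HTree.Huff.cost_le_packing hP'.packing.swap hwh hR.1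
        (by rw [hsum, RectPartition.Rect.area, mul_comm]) hH hl').trans_eq ?_
      simp only [RectPartition.totalPerim, RectPartition.Rect.perim, add_comm]
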